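/- Let $A=(a_{ij})_{i,j\in I}$ be a generalized Cartan matrix with finite index set $I$, and let $\mathbf h_{\mathbb R}$ be a finite-dimensional real vector space with linearly independent coroots $h_i\in\mathbf h_{\mathbb R}$ and linearly independent roots $\alpha_i\in\mathbf h_{\mathbb R}^*$ such that $\alpha_j(h_i)=a_{ij}$. Let $\mathcal W\subseteq GL(\mathbf h_{\mathbb R}^*)$ be the Weyl group, generated by the reflections $\lambda\mapsto\lambda-\lambda(h_i)\alpha_i$; for $J\subseteq I$ let $\mathcal W_J$ be the subgroup generated by the reflections with index in $J$, and let $\overline F_J=\{\lambda\mid\lambda(h_i)=0\ (i\in J),\ \lambda(h_i)\ge 0\ (i\notin J)\}$. The union $X=\mathcal W\,\overline C$ of the translates of the closed chamber $\overline C=\overline F_\emptyset$ is a convex cone, the Tits cone. Let $\mathrm{Fa}(X)$ be the set of its faces (as a convex cone); the sets $\tau\overline F_J$ ($\tau\in\mathcal W$, $J\subseteq I$) are its closed facets. For $J\subseteq I$ let $J^\perp=\{i\mid a_{ij}=0\text{ for all }j\in J\}$, and let $J^\infty$ be the union of the components of $J$ of non-finite type; $\Theta\subseteq I$ is special if $\Theta=\Theta^\infty$.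 For special $\Theta$ the set $R(\Theta)=\mathcal W_{\Theta^\perp}\overline F_\Theta$ is a face of $X$. For $y\in\mathcal W$ let $\mathrm{red}(y)\subseteq I$ be the set of indices occurring in a reduced expression of $y$, and let ${}^{K}\mathcal W^{J}$ be the set of minimal-length representatives of the double cosets $\mathcal W_K\backslash\mathcal W/\mathcal W_J$. The face monoid $\widehat{\mathcal W}$ is the quotient of the semidirect product $\mathcal W\ltimes\mathrm{Fa}(X)$, with multiplication $(\sigma,R)(\tau,S)=(\sigma\tau,\tau^{-1}R\cap S)$, by the congruence $(\sigma,R)\sim(\sigma',R')$ iff $R=R'$ and $\sigma^{-1}\sigma'$ fixes $R$ pointwise. The class of $(\sigma,R)$ is denoted by $\sigma\langle R\rangle$; write $\sigma$ for $\sigma\langle X\rangle$ and $\langle R\rangle$ for $1\langle R\rangle$. Let $\widehat{\mathcal W}_J=\{\sigma\langle R\rangle\mid\sigma\in\mathcal W_J,\ R\supseteq R(J^\infty)\}$. The Coxeter complex $\mathcal C=\{\tau\mathcal W_J\mid\tau\in\mathcal W,\ J\subseteq I\}$ is ordered by reverse inclusion, and $\mathcal W$ acts on it by left multiplication. Sending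 $\tau\mathcal W_J$ to $\tau\overline F_J$ identifies $\mathcal C$ with the set of closed facets of $X$, ordered by inclusion. An action of $\widehat{\mathcal W}$ on $\mathcal C$ extending that of $\mathcal W$ is called good if it is order preserving and the stabilizer of $\mathcal W_J$ is $\widehat{\mathcal W}_J$ for all $J\subseteq I$. **Proposition (Good action 1).** There is a faithful, good action $\triangleright$ of $\widehat{\mathcal W}$ on $\mathcal C$ which, under the identification of $\mathcal C$ with the set of closed facets, is given by $$\sigma\langle R\rangle\triangleright\overline F=\sigma(R\cap\overline F)\qquad(\sigma\in\mathcal W,\ R\in\mathrm{Fa}(X),\ \overline F\text{ a closed facet}).$$ Explicitly, every element of $\widehat{\mathcal W}$ has the form $\sigma_1\langle R(\Theta)\rangle\sigma_2$ with $\sigma_1,\sigma_2\in\mathcal W$ and $\Theta$ special. For $\tau\in\mathcal W$ and $J\subseteq I$ there is a decomposition $\sigma_2\tau=a_1a_2yc$ with $a_1\in\mathcal W_{\Theta^\perp}$, $a_2\in\mathcal W_\Theta$, $y\in{}^{\Theta\cup\Theta^\perp}\mathcal W^J$, $c\in\mathcal W_J$, and for every such decomposition $$\sigma_1\langle R(\Theta)\rangle\sigma_2\triangleright\tau\mathcal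 W_J=\sigma_1a_1\mathcal W_{\Theta\cup J\cup\mathrm{red}(y)}.$$ -/

import Mathlib

open scoped Pointwise

namespace FaceMonoid

/-- A generalized Cartan matrix over the index set `I`. -/
structure GCM (I : Type*) where
  a : Matrix I I ℤ
  diag : ∀ i, a i i = 2
  offDiag : ∀ i j, i ≠ j → a i j ≤ 0
  zero_iff : ∀ i j, a i j = 0 ↔ a j i = 0

namespace GCM

variable {I : Type*} (A : GCM I)

/-- The vertex set of the connected component of `i` in the (Dynkin) diagram of the
submatrix `A_J`; used for `i ∈ J`. -/
def component (J : Set I) (i : I) : Set I :=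
  {k | Relation.ReflTransGen (fun p q => q ∈ J ∧ A.a p q ≠ 0) i k}

open scoped Classical in
/-- The submatrix `A_K` is of finite type, in the sense of the classification of indecomposable
generalized Cartan matrices; used for connected `K`. -/
def IsFiniteType [Finite I] (K : Set I) : Prop :=
  letI : Fintype K := Fintype.ofFinite K
  let B : Matrix K K ℝ := Matrix.of fun p q => (A.a p q : ℝ)
  B.det ≠ 0 ∧
  (∃ u : K → ℝ, (∀ k, 0 < u k) ∧ ∀ k, 0 < B.mulVec u k) ∧
  ∀ v : K → ℝ, (∀ k, 0 ≤ B.mulVec v k) → (∀ k, 0 < v k) ∨ v = 0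

/-- `J^∞`: the union of the components of `J` which are of non-finite type. -/
def inf [Finite I] (J : Set I) : Set I :=
  {i | i ∈ J ∧ ¬ A.IsFiniteType (A.component J i)}

/-- A set of indices is special if all its components are of non-finite type. -/
def IsSpecial [Finite I] (Θ : Set I) : Prop := Θ = A.inf Θ

/-- `J^⊥`. -/
def perp (J : Set I) : Set I := {i | ∀ j ∈ J, A.a i j = 0}

end GCM

/-- A real realization of a generalized Cartan matrix: linearly independent simple coroots `h_i`
in a real vector space `h`, and linearly independent simple roots `α_i` in its dual, with
`α_j (h_i) = a_ij`. -/
structure Realization {I : Type*} (A : GCM I) (h : Type*) [AddCommGroup h] [Module ℝ h] where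
  coroot : I → h
  root : I → Module.Dual ℝ h
  coroot_indep : LinearIndependent ℝ coroot
  root_indep : LinearIndependent ℝ root
  root_coroot : ∀ i j, root j (coroot i) = A.a i j

namespace Realization

variable {I : Type*} {A : GCM I} {h : Type*} [AddCommGroup h] [Module ℝ h] (ρ : Realization A h)

/-! The Weyl group as a group of linear transformations of the dual space. -/

theorem eval_root (i : I) : Module.Dual.eval ℝ h (ρ.coroot i) (ρ.root i) = 2 := by
  simp [ρ.root_coroot, A.diag]

/-- The reflection `λ ↦ λ - λ(h_i) α_i`. -/
noncomputable def reflection (i : I) : Module.Dual ℝ h ≃ₗ[ℝ] Module.Dual ℝ h :=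
  Module.reflection (ρ.eval_root i)

/-- The Weyl group `W`. -/
def weyl : Subgroup (Module.Dual ℝ h ≃ₗ[ℝ] Module.Dual ℝ h) :=
  Subgroup.closure (Set.range ρ.reflection)

/-- The simple reflection `σ_i` as an element of the Weyl group. -/
noncomputable def simple (i : I) : ρ.weyl :=
  ⟨ρ.reflection i, Subgroup.subset_closure ⟨i, rfl⟩⟩

/-- The standard parabolic subgroup `W_J`. -/
def parabolic (J : Set I) : Subgroup ρ.weyl := Subgroup.closure (ρ.simple '' J)

/-- The word `l` in the simple reflections is an expression for `w`. -/
def IsExpr (l : List I) (w : ρ.weyl) : Prop := (l.map ρ.simple).prod = w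

/-- The length of `w` with respect to the simple reflections. -/
noncomputable def length (w : ρ.weyl) : ℕ :=
  sInf {n | ∃ l : List I, ρ.IsExpr l w ∧ l.length = n}

/-- `red w`: the set of indices occurring in a reduced expression of `w` (which does not depend on
the reduced expression). -/
def red (w : ρ.weyl) : Set I :=
  {i | ∃ l : List I, ρ.IsExpr l w ∧ l.length = ρ.length w ∧ i ∈ l}

/-- The minimal double coset representatives of `W_K \ W / W_J`: the elements which have minimal
length in their double coset. -/
def minRep (K J : Set I) : Set ρ.weyl :=
  {y | ∀ b ∈ ρ.parabolic K, ∀ c ∈ ρ.parabolic J, ρ.length y ≤ ρ.length (b * y * c)}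

/-! The Tits cone, its facets and its faces. -/

/-- The closed facet of type `J` of the closed fundamental chamber. -/
def closedFacet (J : Set I) : Set (Module.Dual ℝ h) :=
  {l | (∀ i ∈ J, l (ρ.coroot i) = 0) ∧ ∀ i ∉ J, 0 ≤ l (ρ.coroot i)}

/-- The closed fundamental chamber. -/
def chamber : Set (Module.Dual ℝ h) := {l | ∀ i, 0 ≤ l (ρ.coroot i)}

/-- The union of the `W`-translates of the closed fundamental chamber. -/
def titsSet : Set (Module.Dual ℝ h) := ⋃ w : ρ.weyl, w • ρ.chamber

/-- The Tits cone `X`, as a convex cone. (The union of the translates of the closed chamber is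
already convex by a theorem of Tits, so that generating a cone adds nothing.) -/
def titsCone : PointedCone ℝ (Module.Dual ℝ h) := PointedCone.hull ℝ ρ.titsSet

/-- The linear endomorphism given by an element of the Weyl group. -/
def act (w : ρ.weyl) : Module.Dual ℝ h →ₗ[ℝ] Module.Dual ℝ h :=
  (w : Module.Dual ℝ h ≃ₗ[ℝ] Module.Dual ℝ h).toLinearMap

theorem act_apply (w : ρ.weyl) (l : Module.Dual ℝ h) : ρ.act w l = w • l := rfl

theorem smul_mem_titsCone (w : ρ.weyl) {l : Module.Dual ℝ h} (hl : l ∈ ρ.titsCone) :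
    w • l ∈ ρ.titsCone := by
  have key : ρ.titsCone ≤ PointedCone.comap (ρ.act w) ρ.titsCone := by
    refine Submodule.span_le.2 fun x hx => ?_
    obtain ⟨v, hv⟩ := Set.mem_iUnion.1 hx
    refine Submodule.subset_span (Set.mem_iUnion.2 ⟨w * v, ?_⟩)
    rw [mul_smul]
    exact Set.smul_mem_smul_set hv
  exact key hl

theorem comap_titsCone (w : ρ.weyl) :
    PointedCone.comap (ρ.act w) ρ.titsCone = ρ.titsCone := by
  ext l
  refine ⟨fun hl => ?_, fun hl => ρ.smul_mem_titsCone w hl⟩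
  have := ρ.smul_mem_titsCone w⁻¹ (l := w • l) hl
  rwa [inv_smul_smul] at this

/-- The set `Fa(X)` of the faces of the Tits cone. -/
def Face : Type _ := {R : PointedCone ℝ (Module.Dual ℝ h) // R.IsFaceOf ρ.titsCone}

variable {ρ}

/-- The face as a subset of the dual space. -/
def Face.carrier (R : ρ.Face) : Set (Module.Dual ℝ h) := (R.1 : Set (Module.Dual ℝ h))

theorem Face.ext {R S : ρ.Face} (hRS : R.carrier = S.carrier) : R = S :=
  Subtype.ext (SetLike.coe_injective hRS)

/-- The face `w⁻¹ R`. -/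
def Face.translateInv (R : ρ.Face) (w : ρ.weyl) : ρ.Face :=
  ⟨PointedCone.comap (ρ.act w) R.1, by
    have := R.2.comap (ρ.act w)
    rwa [ρ.comap_titsCone] at this⟩

theorem Face.carrier_translateInv (R : ρ.Face) (w : ρ.weyl) :
    (R.translateInv w).carrier = w⁻¹ • R.carrier := by
  ext l
  rw [Set.mem_inv_smul_set_iff]
  rfl

/-- The intersection of two faces. -/
def Face.inter (R S : ρ.Face) : ρ.Face := ⟨R.1 ⊓ S.1, R.2.inf_left S.2⟩

theorem Face.carrier_inter (R S : ρ.Face) : (R.inter S).carrier = R.carrier ∩ S.carrier := rfl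

variable (ρ)

/-- The Tits cone as a face of itself. -/
def topFace : ρ.Face := ⟨ρ.titsCone, .refl _⟩

/-- `R(Θ) = W_{Θ^⊥} F̄_Θ`, as a set. -/
def specialSet (Θ : Set I) : Set (Module.Dual ℝ h) :=
  ⋃ w ∈ ρ.parabolic (A.perp Θ), w • ρ.closedFacet Θ

/-! The face monoid. -/

/-- The underlying set `W × Fa(X)` of the semidirect product of `W` and `(Fa(X), ∩)`. -/
@[ext]
structure Pair where
  elt : ρ.weyl
  face : ρ.Face

variable {ρ}

/-- `(σ, R) (τ, S) = (σ τ, τ⁻¹ R ∩ S)`. -/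
instance : Mul ρ.Pair := ⟨fun p q => ⟨p.elt * q.elt, (p.face.translateInv q.elt).inter q.face⟩⟩

instance : One ρ.Pair := ⟨⟨1, ρ.topFace⟩⟩

theorem Pair.mul_elt (p q : ρ.Pair) : (p * q).elt = p.elt * q.elt := rfl

theorem Pair.mem_mul_face (p q : ρ.Pair) (l : Module.Dual ℝ h) :
    l ∈ (p * q).face.carrier ↔ q.elt • l ∈ p.face.carrier ∧ l ∈ q.face.carrier := Iff.rfl

instance : Monoid ρ.Pair where
  mul_assoc p q r := by
    refine Pair.ext (mul_assoc _ _ _) (Face.ext (Set.ext fun l => ?_))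
    simp only [Pair.mem_mul_face, Pair.mul_elt, mul_smul, and_assoc]
  one_mul p := by
    refine Pair.ext (one_mul _) (Face.ext (Set.ext fun l => ?_))
    rw [Pair.mem_mul_face]
    exact ⟨fun hl => hl.2, fun hl => ⟨ρ.smul_mem_titsCone _ (p.face.2.le hl), hl⟩⟩
  mul_one p := by
    refine Pair.ext (mul_one _) (Face.ext (Set.ext fun l => ?_))
    rw [Pair.mem_mul_face]
    refine ⟨fun hl => ?_, fun hl => ⟨?_, p.face.2.le hl⟩⟩
    · have h1 := hl.1
      rwa [show (1 : ρ.Pair).elt = 1 from rfl, one_smul] at h1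
    · rwa [show (1 : ρ.Pair).elt = 1 from rfl, one_smul]

variable (ρ)

/-- The congruence relation: `(σ, R) ∼ (σ', R')` iff `R = R'` and `σ⁻¹ σ'` fixes `R` pointwise. -/
def con : Con ρ.Pair where
  r p q := p.face = q.face ∧ ∀ l ∈ p.face.carrier, (p.elt⁻¹ * q.elt) • l = l
  iseqv :=
    { refl := fun p => ⟨rfl, fun l _ => by simp⟩
      symm := fun {p q} hpq => ⟨hpq.1.symm, fun l hl => by
        rw [mul_smul, inv_smul_eq_iff]
        have := hpq.2 l (hpq.1 ▸ hl)
        rw [mul_smul, inv_smul_eq_iff] at this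
        exact this.symm⟩
      trans := fun {p q r} hpq hqr => ⟨hpq.1.trans hqr.1, fun l hl => by
        have h1 := hpq.2 l hl
        have h2 := hqr.2 l (hpq.1 ▸ hl)
        rw [mul_smul, inv_smul_eq_iff] at h1 h2 ⊢
        exact h2.trans h1⟩ }
  mul' := by
    rintro p p' q q' ⟨hp, hp'⟩ ⟨hq, hq'⟩
    have key : ∀ l ∈ q.face.carrier, q'.elt • l = q.elt • l := fun l hl => by
      have := hq' l hl
      rwa [mul_smul, inv_smul_eq_iff] at this
    refine ⟨Face.ext (Set.ext fun l => ?_), fun l hl => ?_⟩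
    · rw [Pair.mem_mul_face, Pair.mem_mul_face, ← hp, ← hq]
      exact ⟨fun hl => ⟨(key l hl.2).symm ▸ hl.1, hl.2⟩, fun hl => ⟨key l hl.2 ▸ hl.1, hl.2⟩⟩
    · rw [Pair.mem_mul_face] at hl
      have := hp' _ hl.1
      rw [mul_smul, inv_smul_eq_iff] at this
      rw [Pair.mul_elt, Pair.mul_elt, mul_smul, inv_smul_eq_iff, mul_smul, mul_smul,
        key l hl.2, this]

/-- The face monoid `Ŵ` associated to the Weyl group. -/
abbrev WHat : Type _ := ρ.con.Quotient

variable {ρ}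

/-- The element `σ⟨R⟩` of the face monoid. -/
def cls (σ : ρ.weyl) (R : ρ.Face) : ρ.WHat := ((⟨σ, R⟩ : ρ.Pair) : ρ.con.Quotient)

/-- The element `σ = σ⟨X⟩`. -/
def unit (σ : ρ.weyl) : ρ.WHat := cls σ ρ.topFace

/-- The idempotent `⟨R⟩ = 1⟨R⟩`. -/
def idem (R : ρ.Face) : ρ.WHat := cls 1 R

variable (ρ)

/-- The parabolic submonoid `Ŵ_J = W_J E_J`, as a set; `E_J` consists of the `⟨R⟩` with
`R ⊇ R(J^∞)`. -/
def parabolicHat [Finite I] (J : Set I) : Set ρ.WHat :=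
  {m | ∃ σ ∈ ρ.parabolic J, ∃ R : ρ.Face, ρ.specialSet (A.inf J) ⊆ R.carrier ∧
    m = unit σ * idem R}

/-! The Coxeter complex and the closed facets of the Tits cone. -/

/-- The Coxeter complex: the set of the cosets `σ W_J`. -/
def Complex : Type _ :=
  {S : Set ρ.weyl // ∃ (σ : ρ.weyl) (J : Set I), S = σ • (ρ.parabolic J : Set ρ.weyl)}

/-- The order of the Coxeter complex is the reverse inclusion. -/
instance : PartialOrder ρ.Complex :=
  PartialOrder.lift (fun S => OrderDual.toDual S.1)
    fun _ _ hST => Subtype.ext (OrderDual.toDual.injective hST)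

theorem Complex.le_iff (S T : ρ.Complex) : S ≤ T ↔ T.1 ⊆ S.1 := Iff.rfl

/-- The Weyl group acts on its Coxeter complex by multiplication from the left. -/
instance : MulAction ρ.weyl ρ.Complex where
  smul σ S := ⟨σ • S.1, by
    obtain ⟨τ, J, hS⟩ := S.2
    exact ⟨σ * τ, J, by rw [hS, mul_smul]⟩⟩
  one_smul S := Subtype.ext (one_smul _ S.1)
  mul_smul σ τ S := Subtype.ext (mul_smul σ τ S.1)

/-- The element `τ W_J` of the Coxeter complex. -/
def coset (τ : ρ.weyl) (J : Set I) : ρ.Complex := ⟨τ • (ρ.parabolic J : Set ρ.weyl), τ, J, rfl⟩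

/-- The set of the closed facets `τ F̄_J` of the Tits cone. It is ordered by inclusion. -/
abbrev Facet : Type _ :=
  {F : Set (Module.Dual ℝ h) // ∃ (τ : ρ.weyl) (J : Set I), F = τ • ρ.closedFacet J}

/-- The closed facet `τ F̄_J`. -/
def facet (τ : ρ.weyl) (J : Set I) : ρ.Facet := ⟨τ • ρ.closedFacet J, τ, J, rfl⟩

/-- An action of the face monoid on the Coxeter complex is good if it extends the action of the
Weyl group, the stabilizer of `W_J` is the parabolic submonoid of type `J`, and the action is
order preserving. -/
structure IsGoodAction [Finite I] [MulAction ρ.WHat ρ.Complex] : Prop where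
  extends_weyl : ∀ (σ : ρ.weyl) (c : ρ.Complex), (unit σ : ρ.WHat) • c = σ • c
  stabilizer : ∀ J : Set I,
    (MulAction.stabilizerSubmonoid ρ.WHat (ρ.coset 1 J) : Set ρ.WHat) = ρ.parabolicHat J
  order_preserving : ∀ (m : ρ.WHat) (c d : ρ.Complex), c ≤ d → m • c ≤ m • d

end Realization

end FaceMonoid

/-! The geometry rests on one fact, `exists_pos_coroot_of_length_le`: if ws_i is not shorter than w,
then w h_i is a nonnegative integral combination of simple coroots. Peeling letters off a reduced
word then gives `fixed_of_dominant`, and from it: the closed chamber is a strict fundamental domain,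
stabilizers of its points are parabolic, reduced words of elements of W_K use only letters of K, and
inclusion of closed facets matches reverse inclusion of cosets (`complexIso`). A similar induction
on length shows that the union of the translates of the chamber is convex.

The formula σ(R ∩ F̄) makes sense because a face meets a closed facet in a closed facet
(`Face.exists_inter_closedFacet`). It is compatible with the product and the congruence, and it
preserves inclusions. The action is faithful because every point of R lies in a closed facet
contained in R, on which σ⟨R⟩ acts as σ.

The stabilizers require that a face containing F̄_J contains R(J^∞) (`specialSet_inf_subset`). This
holds because the finite type part of J has the whole space as Tits cone (`titsCone_eq_top`), so
every vector can be made dominant for that part. The normal form σ₁⟨R(Θ)⟩σ₂ requires that every face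
is a translate of some R(Θ). Here non-finite type enters: it provides a vector v, positive on Θ and
zero elsewhere, with vA ≤ 0, and then β = Σ v_k h_k defines a supporting hyperplane which cuts R(Θ)
out of X (`exists_supporting`).

The explicit formula reduces to R(Θ) ∩ yF̄_J = F̄_{Θ ∪ J ∪ red(y)} for minimal y, since a₁ preserves
R(Θ), a₂ fixes it pointwise and c preserves F̄_J. -/

namespace FaceMonoid

namespace Realization

variable {I : Type*} {A : GCM I} {h : Type*} [AddCommGroup h] [Module ℝ h] (ρ : Realization A h)

/-! ### The length function -/

theorem simple_smul (i : I) (l : Module.Dual ℝ h) :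
    ρ.simple i • l = l - l (ρ.coroot i) • ρ.root i :=
  Module.reflection_apply l (ρ.eval_root i)

theorem simple_smul_apply (i j : I) (l : Module.Dual ℝ h) :
    (ρ.simple i • l) (ρ.coroot j) = l (ρ.coroot j) - A.a j i * l (ρ.coroot i) := by
  simp [simple_smul, ρ.root_coroot, mul_comm]

theorem simple_smul_apply_self (i : I) (l : Module.Dual ℝ h) :
    (ρ.simple i • l) (ρ.coroot i) = -l (ρ.coroot i) := by
  rw [simple_smul_apply, A.diag]; push_cast; ring

theorem simple_smul_eq_self {i : I} {l : Module.Dual ℝ h} (hl : l (ρ.coroot i) = 0) :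
    ρ.simple i • l = l := by
  simp [simple_smul, hl]

theorem weyl_smul_smul (w : ρ.weyl) (c : ℝ) (l : Module.Dual ℝ h) : w • (c • l) = c • (w • l) :=
  (ρ.act w).map_smul c l

theorem weyl_smul_sum {ι : Type*} (s : Finset ι) (w : ρ.weyl) (f : ι → Module.Dual ℝ h) :
    w • ∑ k ∈ s, f k = ∑ k ∈ s, w • f k :=
  map_sum (ρ.act w) f s

@[simp] theorem simple_mul_self (i : I) : ρ.simple i * ρ.simple i = 1 := by
  refine Subtype.ext (LinearEquiv.ext fun l => ?_)
  change ρ.simple i • ρ.simple i • l = l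
  rw [ρ.simple_smul i (ρ.simple i • l), simple_smul_apply_self, simple_smul]
  module

@[simp] theorem simple_inv (i : I) : (ρ.simple i)⁻¹ = ρ.simple i :=
  inv_eq_of_mul_eq_one_left (ρ.simple_mul_self i)

@[simp] theorem simple_mul_cancel_left (i : I) (w : ρ.weyl) :
    ρ.simple i * (ρ.simple i * w) = w := by
  rw [← mul_assoc, simple_mul_self, one_mul]

@[simp] theorem simple_mul_cancel_right (i : I) (w : ρ.weyl) :
    w * ρ.simple i * ρ.simple i = w := by
  rw [mul_assoc, simple_mul_self, mul_one]

/-- The product of the simple reflections along a word. -/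
noncomputable def wordProd (l : List I) : ρ.weyl := (l.map ρ.simple).prod

@[simp] theorem wordProd_nil : ρ.wordProd [] = 1 := rfl

@[simp] theorem wordProd_cons (i : I) (l : List I) :
    ρ.wordProd (i :: l) = ρ.simple i * ρ.wordProd l := by simp [wordProd]

@[simp] theorem wordProd_append (l m : List I) :
    ρ.wordProd (l ++ m) = ρ.wordProd l * ρ.wordProd m := by simp [wordProd]

theorem wordProd_reverse (l : List I) : ρ.wordProd l.reverse = (ρ.wordProd l)⁻¹ := by
  induction l with
  | nil => simp
  | cons i l ih => simp [ih]

theorem exists_wordProd_of_mem_parabolic {J : Set I} {w : ρ.weyl} (hw : w ∈ ρ.parabolic J) :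
    ∃ l : List I, (∀ i ∈ l, i ∈ J) ∧ ρ.wordProd l = w := by
  induction hw using Subgroup.closure_induction with
  | mem x hx => obtain ⟨i, hi, rfl⟩ := hx; exact ⟨[i], by simpa using hi, by simp⟩
  | one => exact ⟨[], by simp, rfl⟩
  | mul x y _ _ hx hy =>
    obtain ⟨l, hl, rfl⟩ := hx
    obtain ⟨m, hm, rfl⟩ := hy
    exact ⟨l ++ m, fun i hi => (List.mem_append.1 hi).elim (hl i) (hm i), by simp⟩
  | inv x _ hx =>
    obtain ⟨l, hl, rfl⟩ := hx
    exact ⟨l.reverse, by simpa using hl, ρ.wordProd_reverse l⟩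

theorem simple_mem_parabolic {J : Set I} {i : I} (hi : i ∈ J) : ρ.simple i ∈ ρ.parabolic J :=
  Subgroup.subset_closure ⟨i, hi, rfl⟩

theorem parabolic_mono {J K : Set I} (hJK : J ⊆ K) : ρ.parabolic J ≤ ρ.parabolic K :=
  Subgroup.closure_mono (Set.image_mono hJK)

theorem wordProd_mem_parabolic {J : Set I} {l : List I} (hl : ∀ i ∈ l, i ∈ J) :
    ρ.wordProd l ∈ ρ.parabolic J := by
  induction l with
  | nil => exact one_mem _
  | cons i l ih =>
    rw [wordProd_cons]
    exact mul_mem (ρ.simple_mem_parabolic (hl i (by simp)))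
      (ih fun j hj => hl j (by simp [hj]))

theorem parabolic_univ : ρ.parabolic Set.univ = ⊤ := by
  have key : ∀ x (hx : x ∈ ρ.weyl), (⟨x, hx⟩ : ρ.weyl) ∈ ρ.parabolic Set.univ := by
    intro x hx
    induction hx using Subgroup.closure_induction with
    | mem x hx => obtain ⟨i, rfl⟩ := hx; exact ρ.simple_mem_parabolic (Set.mem_univ i)
    | one => exact one_mem _
    | mul x y hx hy h1 h2 => exact mul_mem h1 h2
    | inv x hx h1 => exact inv_mem h1
  exact (Subgroup.eq_top_iff' _).2 fun w => key w.1 w.2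

theorem exists_wordProd (w : ρ.weyl) : ∃ l : List I, ρ.wordProd l = w := by
  obtain ⟨l, -, hl⟩ := ρ.exists_wordProd_of_mem_parabolic (J := Set.univ) (w := w)
    (by rw [parabolic_univ]; trivial)
  exact ⟨l, hl⟩

theorem exists_reduced (w : ρ.weyl) : ∃ l : List I, ρ.wordProd l = w ∧ l.length = ρ.length w := by
  obtain ⟨l, hl⟩ := ρ.exists_wordProd w
  exact Nat.sInf_mem (s := {n | ∃ l : List I, ρ.IsExpr l w ∧ l.length = n}) ⟨_, l, hl, rfl⟩

theorem length_wordProd_le (l : List I) : ρ.length (ρ.wordProd l) ≤ l.length :=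
  Nat.sInf_le ⟨l, rfl, rfl⟩

@[simp] theorem length_one : ρ.length 1 = 0 := Nat.le_zero.1 (ρ.length_wordProd_le [])

theorem length_mul_wordProd_le (w : ρ.weyl) (l : List I) :
    ρ.length (w * ρ.wordProd l) ≤ ρ.length w + l.length := by
  obtain ⟨m, rfl, hm⟩ := ρ.exists_reduced w
  rw [← hm, ← wordProd_append, ← List.length_append]
  exact ρ.length_wordProd_le _

theorem length_mul_simple_le (w : ρ.weyl) (i : I) :
    ρ.length (w * ρ.simple i) ≤ ρ.length w + 1 := by
  simpa using ρ.length_mul_wordProd_le w [i]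

theorem length_le_mul_simple (w : ρ.weyl) (i : I) :
    ρ.length w ≤ ρ.length (w * ρ.simple i) + 1 := by
  simpa using ρ.length_mul_simple_le (w * ρ.simple i) i

theorem length_inv (w : ρ.weyl) : ρ.length w⁻¹ = ρ.length w := by
  have key : ∀ w : ρ.weyl, ρ.length w⁻¹ ≤ ρ.length w := fun w => by
    obtain ⟨m, rfl, hm⟩ := ρ.exists_reduced w
    rw [← wordProd_reverse, ← hm, ← List.length_reverse]
    exact ρ.length_wordProd_le _
  exact (key w).antisymm (by simpa using key w⁻¹)

theorem length_simple_mul_le (w : ρ.weyl) (i : I) :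
    ρ.length (ρ.simple i * w) ≤ ρ.length w + 1 := by
  simpa [← ρ.length_inv (ρ.simple i * w), ← ρ.length_inv w] using ρ.length_mul_simple_le w⁻¹ i

/-! ### Rank two -/

theorem wordProd_inv_smul_cons (i : I) (u : List I) (l : Module.Dual ℝ h) :
    (ρ.wordProd (i :: u))⁻¹ • l = (ρ.wordProd u)⁻¹ • ρ.simple i • l := by
  rw [wordProd_cons, mul_inv_rev, simple_inv, mul_smul]

/-- The braid relation of order `m`. -/
def Braid (m : ℕ) (s t : I) : Prop :=
  ρ.wordProd (CoxeterSystem.alternatingWord s t m) =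
    ρ.wordProd (CoxeterSystem.alternatingWord t s m)

variable {ρ}

theorem Braid.symm {m : ℕ} {s t : I} (H : ρ.Braid m s t) : ρ.Braid m t s := Eq.symm H

theorem weyl_ext {v w : ρ.weyl} (H : ∀ l : Module.Dual ℝ h, v • l = w • l) : v = w :=
  Subtype.ext (LinearEquiv.ext H)

/-- The products 0, 1, 2, 3 of the two Cartan integers give the orders 2, 3, 4, 6; each relation is
checked on an arbitrary functional. -/
theorem braid_two {s t : I} (hst : A.a s t = 0) (hts : A.a t s = 0) : ρ.Braid 2 s t := by
  refine weyl_ext fun l => ?_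
  simp only [CoxeterSystem.alternatingWord, List.concat_eq_append, List.nil_append,
    List.cons_append, wordProd_cons, wordProd_nil, mul_one, mul_smul, simple_smul,
    LinearMap.sub_apply, LinearMap.smul_apply, ρ.root_coroot, hst, hts]
  push_cast
  simp only [smul_eq_mul]
  module

theorem braid_three {s t : I} (hst : A.a s t = -1) (hts : A.a t s = -1) : ρ.Braid 3 s t := by
  refine weyl_ext fun l => ?_
  simp only [CoxeterSystem.alternatingWord, List.concat_eq_append, List.nil_append,
    List.cons_append, wordProd_cons, wordProd_nil, mul_one, mul_smul, simple_smul,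
    LinearMap.sub_apply, LinearMap.smul_apply, ρ.root_coroot, A.diag, hst, hts]
  push_cast
  simp only [smul_eq_mul]
  module

theorem braid_four {s t : I} (hst : A.a s t = -1) (hts : A.a t s = -2) : ρ.Braid 4 s t := by
  refine weyl_ext fun l => ?_
  simp only [CoxeterSystem.alternatingWord, List.concat_eq_append, List.nil_append,
    List.cons_append, wordProd_cons, wordProd_nil, mul_one, mul_smul, simple_smul,
    LinearMap.sub_apply, LinearMap.smul_apply, ρ.root_coroot, A.diag, hst, hts]
  push_cast
  simp only [smul_eq_mul]
  module

theorem braid_six {s t : I} (hst : A.a s t = -1) (hts : A.a t s = -3) : ρ.Braid 6 s t := by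
  refine weyl_ext fun l => ?_
  simp only [CoxeterSystem.alternatingWord, List.concat_eq_append, List.nil_append,
    List.cons_append, wordProd_cons, wordProd_nil, mul_one, mul_smul, simple_smul,
    LinearMap.sub_apply, LinearMap.smul_apply, ρ.root_coroot, A.diag, hst, hts]
  push_cast
  simp only [smul_eq_mul]
  module

variable (ρ)

/-- The coordinates of the coroot `w h_s`, where `w` is the alternating word of length `n` which
ends in `t`. -/
def altCoeff (s t : I) (A : GCM I) : ℕ → ℤ × ℤ
  | 0 => (1, 0)
  | n + 1 =>
    -- The letter put in front of a word of length n is t for even n and s for odd n; its reflection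
    -- changes only the coordinate of its own coroot.
    if Even n then ((altCoeff s t A n).1, -A.a s t * (altCoeff s t A n).1 - (altCoeff s t A n).2)
    else (-A.a t s * (altCoeff s t A n).2 - (altCoeff s t A n).1, (altCoeff s t A n).2)

theorem alternatingWord_inv_smul_apply (s t : I) (n : ℕ) (l : Module.Dual ℝ h) :
    ((ρ.wordProd (CoxeterSystem.alternatingWord s t n))⁻¹ • l) (ρ.coroot s) =
      (altCoeff s t A n).1 * l (ρ.coroot s) + (altCoeff s t A n).2 * l (ρ.coroot t) := by
  induction n generalizing l with
  | zero => simp [altCoeff, CoxeterSystem.alternatingWord]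
  | succ n ih =>
    rw [CoxeterSystem.alternatingWord_succ', wordProd_inv_smul_cons, ih]
    by_cases hn : Even n
    · simp only [hn, if_true, altCoeff, simple_smul_apply, A.diag]
      push_cast; ring
    · simp only [hn, if_false, altCoeff, simple_smul_apply, A.diag]
      push_cast; ring

/-- The order of the product of two simple reflections is determined by the Cartan integers. -/
theorem altCoeff_nonneg_or_braid {s t : I} (hst : s ≠ t) (n : ℕ) :
    (0 ≤ (altCoeff s t A n).1 ∧ 0 ≤ (altCoeff s t A n).2) ∨ ∃ m ≤ n, 0 < m ∧ ρ.Braid m s t := by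
  have ha := A.offDiag s t hst
  have hb := A.offDiag t s hst.symm
  have hz := A.zero_iff s t
  rcases le_or_gt 4 (A.a s t * A.a t s) with hab | hab
  · left
    -- The invariant says that the coordinate changed next is at most half the sum of its old and
    -- new values. Hence it does not decrease, and a product of Cartan integers of at least 4 passes
    -- the inequality on to the other coordinate.
    have key : ∀ n, (0 ≤ (altCoeff s t A n).1 ∧ 0 ≤ (altCoeff s t A n).2) ∧
        (Even n → 2 * (altCoeff s t A n).2 ≤ -A.a s t * (altCoeff s t A n).1) ∧
        (¬ Even n → 2 * (altCoeff s t A n).1 ≤ -A.a t s * (altCoeff s t A n).2) := by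
      intro n
      induction n with
      | zero => simp [altCoeff, ha]
      | succ n ih =>
        obtain ⟨⟨h1, h2⟩, h3, h4⟩ := ih
        by_cases hn : Even n
        · have h3 := h3 hn
          have hn' : ¬ Even (n + 1) := by simp [Nat.even_add_one, hn]
          simp only [altCoeff, hn, hn', if_true, false_imp_iff, true_and, not_false_eq_true,
            true_imp_iff]
          refine ⟨⟨h1, by linarith⟩, ?_⟩
          nlinarith
        · have h4 := h4 hn
          have hn' : Even (n + 1) := by simp only [Nat.even_add_one, hn, not_false_eq_true]
          simp only [altCoeff, hn, hn', if_false, true_imp_iff, not_true_eq_false,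
            false_imp_iff, and_true]
          refine ⟨⟨by linarith, h2⟩, ?_⟩
          nlinarith
    exact (key n).1
  · obtain ⟨m, hm, hB, hlt⟩ : ∃ m, 0 < m ∧ ρ.Braid m s t ∧ ∀ n < m,
        0 ≤ (altCoeff s t A n).1 ∧ 0 ≤ (altCoeff s t A n).2 := by
      have hcases : (A.a s t = 0 ∧ A.a t s = 0) ∨ (A.a s t = -1 ∧ A.a t s = -1) ∨
          (A.a s t = -1 ∧ A.a t s = -2) ∨ (A.a s t = -2 ∧ A.a t s = -1) ∨
          (A.a s t = -1 ∧ A.a t s = -3) ∨ (A.a s t = -3 ∧ A.a t s = -1) := by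
        by_cases h0 : A.a s t = 0
        · exact .inl ⟨h0, hz.1 h0⟩
        · have h0' : A.a t s ≠ 0 := fun h' => h0 (hz.2 h')
          have h1 : A.a s t ≤ -1 := by omega
          have h2 : A.a t s ≤ -1 := by omega
          have h3 : -4 < A.a s t := by nlinarith
          have h4 : -4 < A.a t s := by nlinarith
          generalize A.a s t = x at *
          generalize A.a t s = y at *
          interval_cases x <;> interval_cases y <;> simp_all
      rcases hcases with ⟨h1, h2⟩ | ⟨h1, h2⟩ | ⟨h1, h2⟩ | ⟨h1, h2⟩ | ⟨h1, h2⟩ | ⟨h1, h2⟩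
      · refine ⟨2, by norm_num, braid_two h1 h2, fun n hn => ?_⟩
        interval_cases n <;> simp [altCoeff, h1]
      · refine ⟨3, by norm_num, braid_three h1 h2, fun n hn => ?_⟩
        interval_cases n <;> simp [altCoeff, h1, h2]
      · refine ⟨4, by norm_num, braid_four h1 h2, fun n hn => ?_⟩
        interval_cases n <;> simp [altCoeff, h1, h2, Nat.even_iff]
      · refine ⟨4, by norm_num, (braid_four h2 h1).symm, fun n hn => ?_⟩
        interval_cases n <;> simp [altCoeff, h1, h2, Nat.even_iff]
      · refine ⟨6, by norm_num, braid_six h1 h2, fun n hn => ?_⟩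
        interval_cases n <;> simp [altCoeff, h1, h2, Nat.even_iff]
      · refine ⟨6, by norm_num, (braid_six h2 h1).symm, fun n hn => ?_⟩
        interval_cases n <;> simp [altCoeff, h1, h2, Nat.even_iff]
    rcases lt_or_ge n m with hnm | hnm
    · exact .inl (hlt n hnm)
    · exact .inr ⟨m, hnm, hm, hB⟩

theorem alternatingWord_suffix {s t : I} {m n : ℕ} (hmn : m ≤ n) :
    ∃ k : List I, (∀ i ∈ k, i = s ∨ i = t) ∧ k.length + m = n ∧
      CoxeterSystem.alternatingWord s t n = k ++ CoxeterSystem.alternatingWord s t m := by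
  induction n, hmn using Nat.le_induction with
  | base => exact ⟨[], by simp⟩
  | succ n hmn ih =>
    obtain ⟨k, hk, hl, he⟩ := ih
    rw [CoxeterSystem.alternatingWord_succ', he]
    refine ⟨(if Even n then t else s) :: k, ?_, by simp; omega, rfl⟩
    intro i hi
    rcases List.mem_cons.1 hi with rfl | hi
    · split_ifs <;> simp
    · exact hk i hi

theorem mem_alternatingWord {s t i : I} {n : ℕ} (hi : i ∈ CoxeterSystem.alternatingWord s t n) :
    i = s ∨ i = t := by
  induction n with
  | zero => simp [CoxeterSystem.alternatingWord] at hi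
  | succ n ih =>
    rw [CoxeterSystem.alternatingWord_succ'] at hi
    rcases List.mem_cons.1 hi with rfl | hi
    · split_ifs <;> simp
    · exact ih hi

/-- A word in `s` and `t` without repetitions which does not end in `s` is alternating. -/
theorem eq_alternatingWord {s t : I} (u : List I) (hu : ∀ i ∈ u, i = s ∨ i = t)
    (hrep : ∀ (i : I) (k m : List I), u ≠ k ++ i :: i :: m) (hlast : ∀ k, u ≠ k ++ [s]) :
    u = CoxeterSystem.alternatingWord s t u.length := by
  induction u using List.reverseRecOn generalizing s t with
  | nil => rfl
  | append_singleton u x ih =>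
    have hx : x = t := (hu x (by simp)).resolve_left fun hx => hlast u (by rw [hx])
    subst hx
    have := ih (s := x) (t := s) (fun i hi => (hu i (by simp [hi])).symm)
      (fun i k m hk => hrep i k (m ++ [x]) (by simp [hk]))
      (fun k hk => hrep x k [] (by simp [hk]))
    rw [List.length_append, List.length_singleton, CoxeterSystem.alternatingWord_succ, ← this,
      List.concat_eq_append]

/-- Minimality forces u to alternate and to end in t. If u were at least as long as a braid
relation, that relation would replace its tail by one ending in s, and us would have a shorter
expression. So the nonnegative alternative of `altCoeff_nonneg_or_braid` applies. -/
theorem exists_coeff_of_reduced_pair {s t : I} (hst : s ≠ t) (u : List I)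
    (hu : ∀ i ∈ u, i = s ∨ i = t)
    (h1 : ∀ k : List I, (∀ i ∈ k, i = s ∨ i = t) → ρ.wordProd k = ρ.wordProd u →
      u.length ≤ k.length)
    (h2 : ∀ k : List I, (∀ i ∈ k, i = s ∨ i = t) → ρ.wordProd k = ρ.wordProd u * ρ.simple s →
      u.length ≤ k.length) :
    ∃ p q : ℕ, ∀ l : Module.Dual ℝ h, ((ρ.wordProd u)⁻¹ • l) (ρ.coroot s) =
      p * l (ρ.coroot s) + q * l (ρ.coroot t) := by
  have halt := eq_alternatingWord u hu (fun i k m hk => by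
      have := h1 (k ++ m) (fun j hj => hu j (by
        rw [hk]; simp only [List.mem_append, List.mem_cons] at hj ⊢; tauto)) (by simp [hk])
      rw [hk] at this
      simp at this)
    (fun k hk => by
      have := h2 k (fun j hj => hu j (by rw [hk]; simp [hj])) (by simp [hk])
      rw [hk] at this
      simp at this)
  rcases ρ.altCoeff_nonneg_or_braid hst u.length with ⟨hp, hq⟩ | ⟨m, hm, hm0, hB⟩
  · obtain ⟨p, hp⟩ := Int.eq_ofNat_of_zero_le hp
    obtain ⟨q, hq⟩ := Int.eq_ofNat_of_zero_le hq
    refine ⟨p, q, fun l => ?_⟩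
    conv_lhs => rw [halt]
    rw [alternatingWord_inv_smul_apply, hp, hq]
    simp
  · exfalso
    obtain ⟨k, hk, hkl, hke⟩ := alternatingWord_suffix (s := s) (t := t) hm
    obtain ⟨m, rfl⟩ := Nat.exists_eq_succ_of_ne_zero hm0.ne'
    have := h2 (k ++ CoxeterSystem.alternatingWord s t m) (fun i hi => by
        rcases List.mem_append.1 hi with hi | hi
        · exact hk i hi
        · exact mem_alternatingWord hi) (by
        rw [halt, hke, wordProd_append, wordProd_append, hB, CoxeterSystem.alternatingWord_succ,
          List.concat_eq_append, wordProd_append]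
        simp [mul_assoc])
    rw [List.length_append, CoxeterSystem.length_alternatingWord] at this
    omega

/-! ### Positivity of coroots -/

/-- The additive submonoid `Q^∨_+` generated by the simple coroots. -/
def coneQ : AddSubmonoid h := AddSubmonoid.closure (Set.range ρ.coroot)

theorem coroot_mem_coneQ (i : I) : ρ.coroot i ∈ ρ.coneQ := AddSubmonoid.subset_closure ⟨i, rfl⟩

/-- Here β is w h_s, described through functionals because the group acts on the dual space.
Induction on length reduces the claim to the dihedral group of s and of a right descent t of w. -/
theorem exists_pos_coroot_of_length_le (w : ρ.weyl) (s : I)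
    (hw : ρ.length w ≤ ρ.length (w * ρ.simple s)) :
    ∃ β ∈ ρ.coneQ, ∀ l : Module.Dual ℝ h, (w⁻¹ • l) (ρ.coroot s) = l β := by
  induction hn : ρ.length w using Nat.strong_induction_on generalizing w s with
  | _ n ih =>
    by_cases hw1 : w = 1
    · subst hw1
      exact ⟨ρ.coroot s, ρ.coroot_mem_coneQ s, fun l => by simp⟩
    obtain ⟨t, ht⟩ : ∃ t, ρ.length (w * ρ.simple t) + 1 = ρ.length w := by
      obtain ⟨l, hl, hlen⟩ := ρ.exists_reduced w
      induction l using List.reverseRecOn with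
      | nil => exact absurd hl.symm hw1
      | append_singleton l t _ =>
        refine ⟨t, le_antisymm ?_ (ρ.length_le_mul_simple w t)⟩
        have : w * ρ.simple t = ρ.wordProd l := by rw [← hl]; simp
        rw [this, ← hlen, List.length_append, List.length_singleton]
        exact Nat.succ_le_succ (ρ.length_wordProd_le l)
    have hst : s ≠ t := by rintro rfl; omega
    classical
    -- Factorizations w = vu with u a word in s and t and lengths adding up. For the shortest v,
    -- neither vs nor vt is shorter than v, so the induction hypothesis makes both v h_s and v h_t
    -- positive.
    let P : ℕ → Prop := fun k => ∃ (v : ρ.weyl) (u : List I), (∀ i ∈ u, i = s ∨ i = t) ∧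
      w = v * ρ.wordProd u ∧ ρ.length v + u.length = ρ.length w ∧ ρ.length v = k
    have hP : P (ρ.length (w * ρ.simple t)) :=
      ⟨w * ρ.simple t, [t], by simp, by simp, by simpa using ht, rfl⟩
    have hex : ∃ k, P k := ⟨_, hP⟩
    obtain ⟨v, u, hu, hvu, hlen, hv⟩ := Nat.find_spec hex
    have hmin : ∀ k, P k → ρ.length v ≤ k := fun k hk => hv ▸ Nat.find_min' hex hk
    have hvn : ρ.length v < n := by have := hmin _ hP; omega
    have hdesc : ∀ x, x = s ∨ x = t → ρ.length v ≤ ρ.length (v * ρ.simple x) := by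
      intro x hx
      by_contra! hlt
      have := ρ.length_le_mul_simple v x
      refine absurd (hmin (ρ.length (v * ρ.simple x)) ⟨v * ρ.simple x, x :: u, ?_, ?_, ?_, rfl⟩)
        (by omega)
      · intro i hi
        rcases List.mem_cons.1 hi with rfl | hi
        · exact hx
        · exact hu i hi
      · rw [hvu]; simp [mul_assoc]
      · simp; omega
    obtain ⟨β, hβ, hβs⟩ := ih _ hvn v s (hdesc s (.inl rfl)) rfl
    obtain ⟨γ, hγ, hγt⟩ := ih _ hvn v t (hdesc t (.inr rfl)) rfl
    obtain ⟨p, q, hpq⟩ := ρ.exists_coeff_of_reduced_pair hst u hu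
      (fun k _ he => by
        have := ρ.length_mul_wordProd_le v k
        rw [he, ← hvu] at this
        omega)
      (fun k _ he => by
        have := ρ.length_mul_wordProd_le v k
        rw [he, ← mul_assoc, ← hvu] at this
        omega)
    refine ⟨p • β + q • γ, add_mem (nsmul_mem hβ p) (nsmul_mem hγ q), fun l => ?_⟩
    rw [hvu, mul_inv_rev, mul_smul, hpq, hβs, hγt]
    simp

theorem coneQ_nonneg {f : Module.Dual ℝ h} (hf : f ∈ ρ.chamber) {β : h} (hβ : β ∈ ρ.coneQ) :
    0 ≤ f β := by
  induction hβ using AddSubmonoid.closure_induction with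
  | mem x hx => obtain ⟨i, rfl⟩ := hx; exact hf i
  | zero => simp
  | add x y _ _ hx hy => rw [map_add]; exact add_nonneg hx hy

theorem smul_apply_coroot_nonneg {f : Module.Dual ℝ h} (hf : f ∈ ρ.chamber) {w : ρ.weyl} {i : I}
    (hw : ρ.length w ≤ ρ.length (ρ.simple i * w)) : 0 ≤ (w • f) (ρ.coroot i) := by
  obtain ⟨β, hβ, he⟩ := ρ.exists_pos_coroot_of_length_le w⁻¹ i (by
    rwa [length_inv, ← ρ.length_inv (w⁻¹ * _), mul_inv_rev, inv_inv, simple_inv])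
  rw [inv_inv] at he
  rw [he]
  exact ρ.coneQ_nonneg hf hβ

/-- Induction along reduced expressions, peeling off letters from the left. -/
theorem reduced_tail {i : I} {L : List I} {w : ρ.weyl} (hL : ρ.wordProd (i :: L) = w)
    (hlen : (i :: L).length = ρ.length w) :
    L.length = ρ.length (ρ.wordProd L) ∧
      ρ.length (ρ.wordProd L) ≤ ρ.length (ρ.simple i * ρ.wordProd L) := by
  have h1 := ρ.length_wordProd_le L
  have h2 := ρ.length_simple_mul_le (ρ.wordProd L) i
  rw [wordProd_cons] at hL
  rw [hL] at h2 ⊢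
  simp at hlen
  omega

/-- For w = s_i v reduced, (vf)(h_i) ≥ 0 by positivity, while (wf)(h_i) = -(vf)(h_i) ≥ 0 by
assumption. Both vanish, so wf = vf and the letter i can be dropped. Asking for dominance only at
the letters of the word makes this usable inside parabolic subgroups. -/
theorem fixed_of_dominant {f : Module.Dual ℝ h} (hf : f ∈ ρ.chamber) (L : List I)
    (hlen : L.length = ρ.length (ρ.wordProd L))
    (hdom : ∀ i ∈ L, 0 ≤ (ρ.wordProd L • f) (ρ.coroot i)) :
    ρ.wordProd L • f = f ∧ ∀ i ∈ L, f (ρ.coroot i) = 0 := by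
  induction L with
  | nil => simp
  | cons i L ih =>
    obtain ⟨hl1, hl2⟩ := ρ.reduced_tail rfl hlen
    have h1 := ρ.smul_apply_coroot_nonneg hf hl2
    have h2 := hdom i (by simp)
    have h3 : ρ.wordProd L • f = ρ.simple i • ρ.wordProd (i :: L) • f := by
      rw [← mul_smul, wordProd_cons, simple_mul_cancel_left]
    have h4 : (ρ.wordProd (i :: L) • f) (ρ.coroot i) = 0 := by
      rw [h3, simple_smul_apply_self] at h1
      linarith
    rw [ρ.simple_smul_eq_self h4] at h3
    obtain ⟨h5, h6⟩ := ih hl1 (fun j hj => by rw [h3]; exact hdom j (by simp [hj]))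
    rw [← h3] at h4 ⊢
    refine ⟨h5, fun j hj => ?_⟩
    rcases List.mem_cons.1 hj with rfl | hj
    · rwa [h5] at h4
    · exact h6 j hj

/-! ### The fundamental chamber -/

theorem closedFacet_subset_chamber (J : Set I) : ρ.closedFacet J ⊆ ρ.chamber := fun f hf i => by
  by_cases hi : i ∈ J
  · exact (hf.1 i hi).ge
  · exact hf.2 i hi

theorem exists_apply_coroot (g : I → ℝ) : ∃ f : Module.Dual ℝ h, ∀ i, f (ρ.coroot i) = g i := by
  let b := Module.Basis.extend ρ.coroot_indep.linearIndepOn_id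
  refine ⟨b.constr ℝ fun x => Function.extend ρ.coroot g 0 x, fun i => ?_⟩
  have hi : ρ.coroot i ∈ (ρ.coroot_indep.linearIndepOn_id).extend (Set.subset_univ _) :=
    Module.Basis.subset_extend _ ⟨i, rfl⟩
  have hb : b ⟨_, hi⟩ = ρ.coroot i := Module.Basis.extend_apply_self _ _
  conv_lhs => rw [← hb]
  rw [Module.Basis.constr_basis]
  exact ρ.coroot_indep.injective.extend_apply g 0 i

/-- There is an element in the relative interior of the closed facet of type `J`. -/
theorem exists_generic (J : Set I) : ∃ f : Module.Dual ℝ h,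
    (∀ i ∈ J, f (ρ.coroot i) = 0) ∧ ∀ i ∉ J, 0 < f (ρ.coroot i) := by
  classical
  obtain ⟨f, hf⟩ := ρ.exists_apply_coroot (Jᶜ.indicator 1)
  refine ⟨f, fun i hi => by simp [hf, hi], fun i hi => by simp [hf, hi]⟩

theorem parabolic_smul_eq {K : Set I} {w : ρ.weyl} (hw : w ∈ ρ.parabolic K)
    {f : Module.Dual ℝ h} (hf : ∀ i ∈ K, f (ρ.coroot i) = 0) : w • f = f := by
  obtain ⟨l, hl, rfl⟩ := ρ.exists_wordProd_of_mem_parabolic hw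
  clear hw
  induction l with
  | nil => simp
  | cons i l ih =>
    have := ih fun j hj => hl j (by simp [hj])
    rw [wordProd_cons, mul_smul, this, ρ.simple_smul_eq_self (hf i (hl i (by simp)))]

theorem eq_of_chamber {f g : Module.Dual ℝ h} (hf : f ∈ ρ.chamber) (hg : g ∈ ρ.chamber)
    {w : ρ.weyl} (hw : w • f = g) : f = g ∧ w ∈ ρ.parabolic {i | f (ρ.coroot i) = 0} := by
  obtain ⟨L, rfl, hL⟩ := ρ.exists_reduced w
  obtain ⟨h1, h2⟩ := ρ.fixed_of_dominant hf L hL (fun i _ => by rw [hw]; exact hg i)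
  exact ⟨h1.symm.trans hw, ρ.wordProd_mem_parabolic h2⟩

/-- W_K fixes a generic point of F̄_K, so by `fixed_of_dominant` that point vanishes at every
letter, and it vanishes only at indices in K. This is why `red` does not depend on the reduced
expression. -/
theorem mem_of_reduced {K : Set I} {L : List I} (hL : L.length = ρ.length (ρ.wordProd L))
    (hw : ρ.wordProd L ∈ ρ.parabolic K) : ∀ i ∈ L, i ∈ K := by
  obtain ⟨f, hf, hf'⟩ := ρ.exists_generic K
  have hfC : f ∈ ρ.chamber := ρ.closedFacet_subset_chamber K ⟨hf, fun i hi => (hf' i hi).le⟩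
  have hfix := ρ.parabolic_smul_eq hw hf
  intro i hi
  by_contra hiK
  exact (hf' i hiK).ne' ((ρ.fixed_of_dominant hfC L hL (fun j _ => by
    rw [hfix]; exact hfC j)).2 i hi)

/-- An element of the chamber and a translate of it by an element of `W_K`, which is dominant with
respect to `K`, coincide. -/
theorem eq_of_parabolic_dominant {K : Set I} {w : ρ.weyl} (hw : w ∈ ρ.parabolic K)
    {f : Module.Dual ℝ h} (hf : f ∈ ρ.chamber) (hdom : ∀ i ∈ K, 0 ≤ (w • f) (ρ.coroot i)) :
    w • f = f := by
  obtain ⟨L, rfl, hL⟩ := ρ.exists_reduced w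
  exact (ρ.fixed_of_dominant hf L hL fun i hi => hdom i (ρ.mem_of_reduced hL hw i hi)).1

/-! ### The Tits cone -/

theorem mem_titsSet {l : Module.Dual ℝ h} :
    l ∈ ρ.titsSet ↔ ∃ (w : ρ.weyl) (c : Module.Dual ℝ h), c ∈ ρ.chamber ∧ l = w • c := by
  simp only [titsSet, Set.mem_iUnion, Set.mem_smul_set, eq_comm]

theorem smul_mem_titsSet (w : ρ.weyl) {l : Module.Dual ℝ h} (hl : l ∈ ρ.titsSet) :
    w • l ∈ ρ.titsSet := by
  obtain ⟨v, c, hc, rfl⟩ := ρ.mem_titsSet.1 hl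
  exact ρ.mem_titsSet.2 ⟨w * v, c, hc, (mul_smul _ _ _).symm⟩

theorem chamber_subset_titsSet : ρ.chamber ⊆ ρ.titsSet :=
  fun c hc => ρ.mem_titsSet.2 ⟨1, c, hc, (one_smul _ _).symm⟩

theorem nonneg_smul_mem_chamber {c : Module.Dual ℝ h} (hc : c ∈ ρ.chamber) {t : ℝ} (ht : 0 ≤ t) :
    t • c ∈ ρ.chamber := fun i => mul_nonneg ht (hc i)

theorem nonneg_smul_mem_titsSet {l : Module.Dual ℝ h} (hl : l ∈ ρ.titsSet) {t : ℝ} (ht : 0 ≤ t) :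
    t • l ∈ ρ.titsSet := by
  obtain ⟨v, c, hc, rfl⟩ := ρ.mem_titsSet.1 hl
  exact ρ.mem_titsSet.2 ⟨v, t • c, ρ.nonneg_smul_mem_chamber hc ht, (ρ.weyl_smul_smul _ _ _).symm⟩

/-- The point where the ray in the direction `y` which starts in a point `x` of the chamber leaves
the chamber. -/
theorem exists_exit [Finite I] {x y : Module.Dual ℝ h} (hx : x ∈ ρ.chamber) (hy : y ∉ ρ.chamber) :
    ∃ (t : ℝ) (i : I), 0 ≤ t ∧ y (ρ.coroot i) < 0 ∧ x + t • y ∈ ρ.chamber ∧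
      (x + t • y) (ρ.coroot i) = 0 := by
  have hS : Set.Nonempty {i | y (ρ.coroot i) < 0} := by
    by_contra hS
    refine hy fun i => ?_
    by_contra! hi
    exact hS ⟨i, hi⟩
  obtain ⟨i, hi, hmin⟩ := Set.exists_min_image _ (fun i => x (ρ.coroot i) / -y (ρ.coroot i))
    (Set.toFinite _) hS
  have hi' : y (ρ.coroot i) < 0 := hi
  refine ⟨x (ρ.coroot i) / -y (ρ.coroot i), i, div_nonneg (hx i) (by linarith), hi, fun j => ?_, ?_⟩
  · have ht : 0 ≤ x (ρ.coroot i) / -y (ρ.coroot i) := div_nonneg (hx i) (by linarith)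
    simp only [LinearMap.add_apply, LinearMap.smul_apply, smul_eq_mul]
    rcases le_or_gt 0 (y (ρ.coroot j)) with hj | hj
    · exact add_nonneg (hx j) (mul_nonneg ht hj)
    · have := (le_div_iff₀ (by linarith)).1 (hmin j hj)
      linarith
  · simp only [LinearMap.add_apply, LinearMap.smul_apply, smul_eq_mul]
    have : y (ρ.coroot i) ≠ 0 := hi'.ne
    field_simp
    ring

theorem add_mem_titsSet_of_chamber [Finite I] (w : ρ.weyl) {x c : Module.Dual ℝ h}
    (hx : x ∈ ρ.chamber) (hc : c ∈ ρ.chamber) : x + w • c ∈ ρ.titsSet := by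
  induction hn : ρ.length w using Nat.strong_induction_on generalizing w x c with
  | _ n ih =>
    by_cases hy : w • c ∈ ρ.chamber
    · exact ρ.chamber_subset_titsSet fun i => add_nonneg (hx i) (hy i)
    obtain ⟨t, i, ht, hi, hz, hzi⟩ := ρ.exists_exit hx hy
    rcases le_or_gt 1 t with ht1 | ht1
    · refine ρ.chamber_subset_titsSet fun j => ?_
      have h1 := hx j
      have h2 := hz j
      simp only [LinearMap.add_apply, LinearMap.smul_apply, smul_eq_mul] at h2 ⊢
      rcases le_or_gt 0 ((w • c) (ρ.coroot j)) with hj | hj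
      · linarith
      · nlinarith
    -- With z = x + t·wc on the wall of i, s_i(x + wc) = z + (1 - t)·s_i wc. The element s_i w is
    -- shorter than w because wc is negative at h_i.
    · have hlt : ρ.length (ρ.simple i * w) < n := by
        by_contra! hle
        exact absurd (ρ.smul_apply_coroot_nonneg hc (hn ▸ hle)) (not_le.2 hi)
      have := ih _ hlt (ρ.simple i * w) hz
        (ρ.nonneg_smul_mem_chamber hc (sub_nonneg.2 ht1.le)) rfl
      convert ρ.smul_mem_titsSet (ρ.simple i) this using 1
      rw [smul_add, ρ.simple_smul_eq_self hzi, ← mul_smul, simple_mul_cancel_left,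
        weyl_smul_smul]
      generalize w • c = d
      module

theorem add_mem_titsSet [Finite I] {x y : Module.Dual ℝ h} (hx : x ∈ ρ.titsSet)
    (hy : y ∈ ρ.titsSet) : x + y ∈ ρ.titsSet := by
  obtain ⟨v, c, hc, rfl⟩ := ρ.mem_titsSet.1 hx
  obtain ⟨w, d, hd, rfl⟩ := ρ.mem_titsSet.1 hy
  convert ρ.smul_mem_titsSet v (ρ.add_mem_titsSet_of_chamber (v⁻¹ * w) hc hd) using 1
  rw [smul_add, ← mul_smul, mul_inv_cancel_left]

theorem coe_titsCone [Finite I] : (ρ.titsCone : Set (Module.Dual ℝ h)) = ρ.titsSet := by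
  refine Set.Subset.antisymm (fun l hl => ?_) Submodule.subset_span
  induction hl using Submodule.span_induction with
  | mem x hx => exact hx
  | zero => exact ρ.chamber_subset_titsSet fun i => le_rfl
  | add x y _ _ hx hy => exact ρ.add_mem_titsSet hx hy
  | smul c x _ hx => exact ρ.nonneg_smul_mem_titsSet hx c.2

theorem mem_titsCone [Finite I] {l : Module.Dual ℝ h} :
    l ∈ ρ.titsCone ↔ ∃ (w : ρ.weyl) (c : Module.Dual ℝ h), c ∈ ρ.chamber ∧ l = w • c := by
  rw [← ρ.mem_titsSet, ← coe_titsCone, SetLike.mem_coe]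

theorem chamber_subset_titsCone {c : Module.Dual ℝ h} (hc : c ∈ ρ.chamber) : c ∈ ρ.titsCone :=
  Submodule.subset_span (ρ.chamber_subset_titsSet hc)

/-! ### Generalized Cartan matrices of finite type -/

/-- A nonzero sum of simple coroots has at least one summand. This gap keeps the orbit of a strictly
dominant point uniformly away from all walls. -/
theorem coneQ_apply_ge {f : Module.Dual ℝ h} {m : ℝ} (hm : 0 ≤ m) (hf : ∀ i, m ≤ f (ρ.coroot i))
    {β : h} (hβ : β ∈ ρ.coneQ) : f β = 0 ∧ β = 0 ∨ m ≤ f β := by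
  induction hβ using AddSubmonoid.closure_induction with
  | mem x hx => obtain ⟨i, rfl⟩ := hx; exact .inr (hf i)
  | zero => simp
  | add x y _ _ hx hy =>
    rw [map_add]
    rcases hx with ⟨h1, h2⟩ | hx <;> rcases hy with ⟨h3, h4⟩ | hy
    · exact .inl (by simp [h2, h4])
    · exact .inr (by linarith)
    · exact .inr (by linarith)
    · exact .inr (by linarith)

theorem abs_smul_apply_ge {f : Module.Dual ℝ h} {m : ℝ} (hm : 0 ≤ m)
    (hf : ∀ i, m ≤ f (ρ.coroot i)) (w : ρ.weyl) (i : I) : m ≤ |(w • f) (ρ.coroot i)| := by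
  have key : ∀ v : ρ.weyl, ρ.length v⁻¹ ≤ ρ.length (v⁻¹ * ρ.simple i) →
      m ≤ (v • f) (ρ.coroot i) := by
    intro v hv
    obtain ⟨β, hβ, he⟩ := ρ.exists_pos_coroot_of_length_le v⁻¹ i hv
    rw [inv_inv] at he
    rcases ρ.coneQ_apply_ge hm hf hβ with ⟨-, rfl⟩ | h1
    -- The coroot v⁻¹h_i is not zero: the root v⁻¹α_i takes the value 2 on it.
    · have := he (v⁻¹ • ρ.root i)
      rw [smul_inv_smul, ρ.root_coroot, A.diag] at this
      norm_num at this
    · rwa [he]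
  rcases le_or_gt (ρ.length w⁻¹) (ρ.length (w⁻¹ * ρ.simple i)) with hw | hw
  · exact (key w hw).trans (le_abs_self _)
  · have := key (ρ.simple i * w) (by
      rw [mul_inv_rev, simple_inv, simple_mul_cancel_right]; exact hw.le)
    rw [mul_smul, simple_smul_apply_self] at this
    exact this.trans (neg_le_abs _)

theorem exists_smul_add_mem_chamber [Finite I] {γ : Module.Dual ℝ h}
    (hγ : ∀ i, 0 < γ (ρ.coroot i)) (l : Module.Dual ℝ h) :
    ∃ t : ℝ, 0 ≤ t ∧ t • γ + l ∈ ρ.chamber := by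
  have := Fintype.ofFinite I
  have hterm : ∀ i, 0 ≤ |l (ρ.coroot i)| / γ (ρ.coroot i) :=
    fun i => div_nonneg (abs_nonneg _) (hγ i).le
  refine ⟨∑ i, |l (ρ.coroot i)| / γ (ρ.coroot i), Finset.sum_nonneg fun i _ => hterm i,
    fun i => ?_⟩
  have h1 := Finset.single_le_sum (fun j _ => hterm j) (Finset.mem_univ i)
  rw [div_le_iff₀ (hγ i)] at h1
  simp only [LinearMap.add_apply, LinearMap.smul_apply, smul_eq_mul]
  linarith [neg_abs_le (l (ρ.coroot i))]

/-- Otherwise the Riesz extension theorem gives a form φ with φ(γ) = 1 which is nonnegative on X. A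
symmetrized form ψ is then bounded below by some ε > 0 on the orbit of γ. At a near-minimum wγ,
comparison with ws_kγ makes every ψ(wα_k) small, hence also ψ(wγ) = Σ u_k ψ(wα_k), a contradiction.
-/
theorem neg_mem_titsCone_of_dominant_combination [Finite I] (u : I → ℝ) (γ : Module.Dual ℝ h)
    (hu : ∀ i, 0 ≤ u i) (hγ : γ = ∑ᶠ j, u j • ρ.root j) (hpos : ∀ i, 0 < γ (ρ.coroot i)) :
    -γ ∈ ρ.titsCone := by
  have := Fintype.ofFinite I
  rw [finsum_eq_sum_of_fintype] at hγ
  by_contra hneg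
  have hγC : γ ∈ ρ.chamber := fun i => (hpos i).le
  have hγ0 : γ ≠ 0 := by
    rintro rfl
    exact hneg (by simp)
  -- a linear form which is nonnegative on the Tits cone
  obtain ⟨φ, hφγ, hφ⟩ : ∃ φ : Module.Dual ℝ h →ₗ[ℝ] ℝ, φ γ = 1 ∧ ∀ l ∈ ρ.titsCone, 0 ≤ φ l := by
    obtain ⟨φ, h1, h2⟩ := riesz_extension ρ.titsCone (LinearPMap.mkSpanSingleton γ (1 : ℝ) hγ0)
      (by
        rintro ⟨x, hx⟩ hxX
        obtain ⟨t, rfl⟩ := Submodule.mem_span_singleton.1 hx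
        rw [LinearPMap.mkSpanSingleton'_apply, smul_eq_mul, mul_one]
        by_contra! ht
        replace ht : t < 0 := ht
        refine hneg ?_
        have := PointedCone.smul_mem ρ.titsCone (inv_nonneg.2 (neg_nonneg.2 ht.le) : 0 ≤ (-t)⁻¹) hxX
        convert this using 1
        simp only [smul_smul]
        rw [inv_neg, neg_mul, inv_mul_cancel₀ ht.ne, neg_one_smul])
      (fun l => by
        obtain ⟨t, -, ht⟩ := ρ.exists_smul_add_mem_chamber hpos l
        exact ⟨⟨t • γ, Submodule.mem_span_singleton.2 ⟨t, rfl⟩⟩, ρ.chamber_subset_titsCone ht⟩)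
    refine ⟨φ, ?_, h2⟩
    exact (h1 ⟨γ, Submodule.mem_span_singleton_self γ⟩).trans
      (LinearPMap.mkSpanSingleton'_apply_self γ (1 : ℝ) _ _)
  obtain ⟨j, hj⟩ : ∃ j, φ (ρ.root j) ≠ 0 := by
    by_contra! hall
    rw [hγ, map_sum] at hφγ
    simp [hall] at hφγ
  have : Nonempty I := ⟨j⟩
  obtain ⟨i₀, hi₀⟩ := Finite.exists_min fun i => γ (ρ.coroot i)
  set m := γ (ρ.coroot i₀) with hm
  have hm0 : 0 < m := hpos i₀
  -- a form whose values on the orbit of `γ` are bounded away from zero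
  let ψ : Module.Dual ℝ h →ₗ[ℝ] ℝ := φ + φ ∘ₗ ρ.act (ρ.simple j)
  have hψ : ∀ l, ψ l = φ l + φ (ρ.simple j • l) := fun l => rfl
  -- Both φ(l) and φ(s_j l) are nonnegative, so their sum is at least the absolute value of their
  -- difference φ(α_j) l(h_j).
  have hψX : ∀ l ∈ ρ.titsCone, |φ (ρ.root j)| * |l (ρ.coroot j)| ≤ ψ l := by
    intro l hl
    have h1 := hφ l hl
    have h2 := hφ _ (ρ.smul_mem_titsCone (ρ.simple j) hl)
    rw [hψ]
    rw [simple_smul, map_sub, map_smul, smul_eq_mul] at h2 ⊢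
    rw [← abs_mul, mul_comm]
    exact abs_le.2 ⟨by linarith, by linarith⟩
  set ε := |φ (ρ.root j)| * m with hε
  have hε0 : 0 < ε := mul_pos (abs_pos.2 hj) hm0
  have hψε : ∀ w : ρ.weyl, ε ≤ ψ (w • γ) := fun w =>
    (mul_le_mul_of_nonneg_left (ρ.abs_smul_apply_ge hm0.le hi₀ w j) (abs_nonneg _)).trans
      (hψX _ (ρ.smul_mem_titsCone w (ρ.chamber_subset_titsCone hγC)))
  have hbdd : BddBelow (Set.range fun w : ρ.weyl => ψ (w • γ)) :=
    ⟨ε, by rintro _ ⟨w, rfl⟩; exact hψε w⟩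
  have hU : 0 < 1 + ∑ k, u k := by
    have := Finset.sum_nonneg fun k (_ : k ∈ Finset.univ) => hu k
    linarith
  -- Chosen so that (1 + Σ u_k)δ = εm, which exceeds the bound (Σ u_k)δ on ψ(wγ)·m derived below.
  set δ := ε * m / (1 + ∑ k, u k) with hδ
  have hδ0 : 0 < δ := by positivity
  obtain ⟨w, hw⟩ := exists_lt_of_ciInf_lt
    (lt_add_of_pos_right (⨅ w : ρ.weyl, ψ (w • γ)) hδ0)
  have hroot : ∀ k, ψ (w • ρ.root k) * m ≤ δ := by
    intro k
    have h1 := ciInf_le hbdd (w * ρ.simple k)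
    rw [mul_smul, simple_smul, smul_sub, weyl_smul_smul, map_sub, ψ.map_smul, smul_eq_mul] at h1
    rcases le_or_gt (ψ (w • ρ.root k)) 0 with h2 | h2
    · nlinarith
    · have := mul_le_mul_of_nonneg_right (hi₀ k) h2.le
      nlinarith
  have hsum : ψ (w • γ) = ∑ k, u k * ψ (w • ρ.root k) := by
    rw [hγ, weyl_smul_sum, map_sum]
    simp [weyl_smul_smul]
  have h1 : ψ (w • γ) * m ≤ (∑ k, u k) * δ := by
    rw [hsum, Finset.sum_mul, Finset.sum_mul]
    refine Finset.sum_le_sum fun k _ => ?_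
    rw [mul_assoc]
    exact mul_le_mul_of_nonneg_left (hroot k) (hu k)
  have h2 : ε * m = δ + (∑ k, u k) * δ := by
    rw [hδ]; field_simp
  have h3 := mul_le_mul_of_nonneg_right (hψε w) hm0.le
  linarith

/-- If the matrix `A` maps a nonnegative vector to a positive vector, then the Tits cone is the
whole space. -/
theorem titsCone_eq_top [Finite I] (u : I → ℝ) (hu : ∀ i, 0 ≤ u i)
    (hpos : ∀ i, 0 < ∑ᶠ j, (A.a i j : ℝ) * u j) : ρ.titsCone = ⊤ := by
  have := Fintype.ofFinite I
  have hγ : ∀ i, 0 < (∑ᶠ j, u j • ρ.root j : Module.Dual ℝ h) (ρ.coroot i) := by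
    intro i
    have := hpos i
    rw [finsum_eq_sum_of_fintype] at this ⊢
    simpa [ρ.root_coroot, mul_comm] using this
  have hneg := ρ.neg_mem_titsCone_of_dominant_combination u _ hu rfl hγ
  generalize (∑ᶠ j, u j • ρ.root j : Module.Dual ℝ h) = γ at hγ hneg
  refine Submodule.eq_top_iff'.2 fun l => ?_
  obtain ⟨t, ht0, h1⟩ := ρ.exists_smul_add_mem_chamber hγ l
  have h2 := add_mem (ρ.chamber_subset_titsCone h1) (PointedCone.smul_mem _ ht0 hneg)
  convert h2 using 1
  module

end Realization

/-! ### Restriction to a subset of the index set -/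

/-- The submatrix `A_K`. -/
def GCM.restrict {I : Type*} (A : GCM I) (K : Set I) : GCM K where
  a p q := A.a p q
  diag p := A.diag p
  offDiag p q hpq := A.offDiag p q fun h => hpq (Subtype.ext h)
  zero_iff p q := A.zero_iff p q

namespace Realization

variable {I : Type*} {A : GCM I} {h : Type*} [AddCommGroup h] [Module ℝ h] (ρ : Realization A h)

/-- The realization of the submatrix `A_K` obtained by restriction. -/
def restrict (K : Set I) : Realization (A.restrict K) h where
  coroot k := ρ.coroot k
  root k := ρ.root k
  coroot_indep := ρ.coroot_indep.comp _ Subtype.val_injective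
  root_indep := ρ.root_indep.comp _ Subtype.val_injective
  root_coroot p q := ρ.root_coroot p q

theorem exists_parabolic_of_restrict {K : Set I} (w : (ρ.restrict K).weyl) :
    ∃ v ∈ ρ.parabolic K, ∀ l : Module.Dual ℝ h, v • l = w • l := by
  obtain ⟨L, rfl⟩ := (ρ.restrict K).exists_wordProd w
  induction L with
  | nil => exact ⟨1, one_mem _, fun l => by simp⟩
  | cons k L ih =>
    obtain ⟨v, hv, he⟩ := ih
    refine ⟨ρ.simple k * v, mul_mem (ρ.simple_mem_parabolic k.2) hv, fun l => ?_⟩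
    rw [mul_smul, he, wordProd_cons, mul_smul]
    rfl

/-- If `A_K` maps a nonnegative vector to a positive vector, then every orbit of `W_K` contains a
`K`-dominant element. -/
theorem exists_parabolic_dominant [Finite I] {K : Set I} (u : I → ℝ) (hu : ∀ i, 0 ≤ u i)
    (hpos : ∀ i ∈ K, 0 < ∑ᶠ j : K, (A.a i j : ℝ) * u j) (l : Module.Dual ℝ h) :
    ∃ w ∈ ρ.parabolic K, ∀ i ∈ K, 0 ≤ (w • l) (ρ.coroot i) := by
  have htop := (ρ.restrict K).titsCone_eq_top (fun k => u k) (fun k => hu k)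
    (fun k => hpos k k.2)
  obtain ⟨w, c, hc, rfl⟩ := (ρ.restrict K).mem_titsCone.1 (htop ▸ Submodule.mem_top (x := l))
  obtain ⟨v, hv, he⟩ := ρ.exists_parabolic_of_restrict w⁻¹
  refine ⟨v, hv, fun i hi => ?_⟩
  rw [he, inv_smul_smul]
  exact hc ⟨i, hi⟩

end Realization

namespace GCM

variable {I : Type*} (A : GCM I)

/-! ### Components and their types -/

theorem ne_zero_symm {i j : I} (hij : A.a i j ≠ 0) : A.a j i ≠ 0 :=
  fun hji => hij ((A.zero_iff i j).2 hji)

variable {A}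

theorem component_subset {J : Set I} {i : I} (hi : i ∈ J) : A.component J i ⊆ J := fun k hk => by
  induction hk with
  | refl => exact hi
  | tail _ h2 _ => exact h2.1

theorem mem_component_self (J : Set I) (i : I) : i ∈ A.component J i := Relation.ReflTransGen.refl

theorem mem_component_of_adj {J : Set I} {i p q : I} (hp : p ∈ A.component J i) (hq : q ∈ J)
    (hpq : A.a p q ≠ 0) : q ∈ A.component J i := Relation.ReflTransGen.tail hp ⟨hq, hpq⟩

theorem mem_component_symm {J : Set I} {i k : I} (hi : i ∈ J) (hk : k ∈ A.component J i) :
    i ∈ A.component J k := by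
  induction hk with
  | refl => exact mem_component_self J i
  | @tail p q hp hpq ih =>
    exact Relation.ReflTransGen.head ⟨component_subset hi hp, A.ne_zero_symm hpq.2⟩ ih

theorem component_eq {J : Set I} {i k : I} (hi : i ∈ J) (hk : k ∈ A.component J i) :
    A.component J k = A.component J i :=
  Set.Subset.antisymm (fun _ hx => Relation.ReflTransGen.trans hk hx)
    fun _ hx => Relation.ReflTransGen.trans (mem_component_symm hi hk) hx

/-- A nonempty subset of a component which is closed under adjacency is the whole component. -/
theorem component_subset_of_closed {J : Set I} {i : I} (hi : i ∈ J) {S : Set I} {k : I} (hk : k ∈ S)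
    (hkc : k ∈ A.component J i)
    (hS : ∀ p ∈ S, ∀ q ∈ A.component J i, A.a p q ≠ 0 → q ∈ S) : A.component J i ⊆ S := by
  intro x hx
  rw [← component_eq hi hkc] at hx
  have : x ∈ S ∧ x ∈ A.component J i := by
    induction hx with
    | refl => exact ⟨hk, hkc⟩
    | tail _ hpq ih =>
      have := mem_component_of_adj ih.2 hpq.1 hpq.2
      exact ⟨hS _ ih.1 _ this hpq.2, this⟩
  exact this.1

variable [Finite I]

theorem inf_subset (J : Set I) : A.inf J ⊆ J := fun _ hi => hi.1

theorem mem_inf_of_mem_component {J : Set I} {i k : I} (hi : i ∈ A.inf J)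
    (hk : k ∈ A.component J i) : k ∈ A.inf J :=
  ⟨component_subset hi.1 hk, by rw [component_eq hi.1 hk]; exact hi.2⟩

theorem component_inf {J : Set I} {i : I} (hi : i ∈ A.inf J) :
    A.component (A.inf J) i = A.component J i := by
  refine Set.Subset.antisymm (fun x hx => ?_) (fun x hx => ?_)
  · induction hx with
    | refl => exact mem_component_self _ _
    | tail _ hpq ih => exact mem_component_of_adj ih hpq.1.1 hpq.2
  · induction hx with
    | refl => exact mem_component_self _ _
    | tail hp hpq ih =>
      exact mem_component_of_adj ih
        (mem_inf_of_mem_component hi (mem_component_of_adj hp hpq.1 hpq.2)) hpq.2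

theorem isSpecial_inf (J : Set I) : A.IsSpecial (A.inf J) := by
  refine Set.Subset.antisymm (fun i hi => ⟨hi, ?_⟩) (inf_subset _)
  rw [component_inf hi]
  exact hi.2

theorem apply_eq_zero_of_mem_inf {J : Set I} {i j : I} (hi : i ∈ J) (hi' : i ∉ A.inf J)
    (hj : j ∈ A.inf J) : A.a i j = 0 := by
  by_contra hij
  exact hi' (mem_inf_of_mem_component hj
    (mem_component_of_adj (mem_component_self J j) hi (A.ne_zero_symm hij)))

theorem diff_inf_subset_perp (J : Set I) : J \ A.inf J ⊆ A.perp (A.inf J) :=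
  fun _ hi _ hj => apply_eq_zero_of_mem_inf hi.1 hi.2 hj

/-- The union of the components of finite type of `J` admits a positive vector which is mapped to a
positive vector. -/
theorem exists_pos_of_diff_inf (J : Set I) : ∃ u : I → ℝ, (∀ i, 0 ≤ u i) ∧
    ∀ i ∈ J \ A.inf J, 0 < ∑ᶠ j : ↥(J \ A.inf J), (A.a i j : ℝ) * u j := by
  classical
  have hfin : ∀ i ∈ J \ A.inf J, A.IsFiniteType (A.component J i) := fun i hi => by
    by_contra h'
    exact hi.2 ⟨hi.1, h'⟩
  have hex : ∀ K : Set I, ∃ u : K → ℝ, A.IsFiniteType K → (∀ k, 0 < u k) ∧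
      ∀ k : K, 0 < ∑ᶠ j : K, (A.a k j : ℝ) * u j := by
    intro K
    by_cases hK : A.IsFiniteType K
    · obtain ⟨-, ⟨u, hu, hu'⟩, -⟩ := hK
      refine ⟨u, fun _ => ⟨hu, fun k => ?_⟩⟩
      let : Fintype K := Fintype.ofFinite K
      rw [finsum_eq_sum_of_fintype]
      exact hu' k
    · exact ⟨0, fun h' => absurd h' hK⟩
  choose U hU using hex
  -- The chosen vector depends only on the component as a set, so all indices of one component use
  -- the same vector.
  let u : I → ℝ := fun i => if i ∈ J \ A.inf J then U (A.component J i) ⟨i, mem_component_self J i⟩ else 0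
  have hu : ∀ i (hi : i ∈ J \ A.inf J) (j : I) (hj : j ∈ A.component J i), u j =
      U (A.component J i) ⟨j, hj⟩ := by
    intro i hi j hj
    have hjJ : j ∈ J \ A.inf J :=
      ⟨component_subset hi.1 hj, fun h' => hi.2 (mem_inf_of_mem_component h'
        (mem_component_symm hi.1 hj))⟩
    have key : ∀ (K L : Set I) (hKL : K = L) (hjK : j ∈ K) (hjL : j ∈ L),
        U K ⟨j, hjK⟩ = U L ⟨j, hjL⟩ := by
      rintro K _ rfl _ _; rfl
    simp only [u, if_pos hjJ]
    exact key _ _ (component_eq hi.1 hj) _ _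
  refine ⟨u, fun i => ?_, fun i hi => ?_⟩
  · by_cases hi : i ∈ J \ A.inf J
    · rw [hu i hi i (mem_component_self J i)]
      exact ((hU _ (hfin i hi)).1 _).le
    · simp only [u, if_neg hi, le_refl]
  · have h1 := (hU _ (hfin i hi)).2 ⟨i, mem_component_self J i⟩
    convert h1 using 1
    rw [finsum_set_coe_eq_finsum_mem (J \ A.inf J) (f := fun j => (A.a i j : ℝ) * u j)]
    have h2 : ∀ j : A.component J i, (A.a i j : ℝ) * U (A.component J i) j = (A.a i j : ℝ) * u j :=
      fun j => by rw [hu i hi j j.2]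
    simp only [h2]
    rw [finsum_set_coe_eq_finsum_mem (A.component J i) (f := fun j => (A.a i j : ℝ) * u j)]
    refine finsum_mem_inter_support_eq _ _ _ (Set.ext fun j => and_congr_left fun hj => ?_)
    refine ⟨fun hjJ => mem_component_of_adj (mem_component_self J i) hjJ.1 fun h0 => hj ?_,
      fun hjK => ⟨component_subset hi.1 hjK, fun h' => hi.2 (mem_inf_of_mem_component h'
        (mem_component_symm hi.1 hjK))⟩⟩
    simp [h0]

/-! ### The theorem of the alternative for non-finite type -/

/-- Either a nonnegative vector is mapped to a positive vector, or a nonnegative nonzero vector is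
mapped to a nonpositive vector by the transposed matrix. -/
theorem exists_pos_or_exists_transpose_nonpos {K : Type*} [Fintype K] (B : Matrix K K ℝ) :
    (∃ u : K → ℝ, (∀ k, 0 ≤ u k) ∧ ∀ k, 0 < B.mulVec u k) ∨
      ∃ v : K → ℝ, v ≠ 0 ∧ (∀ k, 0 ≤ v k) ∧ ∀ k, ∑ i, v i * B i k ≤ 0 := by
  classical
  rw [or_iff_not_imp_left]
  intro hno
  let s : Set (K → ℝ) := {y | ∀ k, 0 < y k}
  let t : Set (K → ℝ) := B.mulVecLin '' {u | ∀ k, 0 ≤ u k}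
  have hs : Convex ℝ s := by
    intro x hx y hy a b ha hb hab k
    have h1 := hx k
    have h2 := hy k
    simp only [Pi.add_apply, Pi.smul_apply, smul_eq_mul]
    rcases ha.eq_or_lt with rfl | ha
    · rw [zero_add] at hab; subst hab; simpa using h2
    · exact add_pos_of_pos_of_nonneg (mul_pos ha h1) (mul_nonneg hb h2.le)
  have hso : IsOpen s := by
    have : s = ⋂ k, {y | 0 < y k} := by ext; simp [s]
    rw [this]
    exact isOpen_iInter_of_finite fun k => isOpen_lt continuous_const (continuous_apply k)
  have ht : Convex ℝ t := by
    refine Convex.linear_image ?_ _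
    intro x hx y hy a b ha hb _ k
    exact add_nonneg (mul_nonneg ha (hx k)) (mul_nonneg hb (hy k))
  have hdisj : Disjoint s t := by
    rw [Set.disjoint_left]
    rintro _ hy ⟨u, hu, rfl⟩
    exact hno ⟨u, hu, fun k => hy k⟩
  -- The open positive orthant is separated from the image of the nonnegative orthant; v will be the
  -- coefficient vector of -f.
  obtain ⟨f, c, hfs, hft⟩ := geometric_hahn_banach_open hs hso ht hdisj
  have hc : c ≤ 0 := by simpa using hft 0 ⟨0, fun k => le_rfl, map_zero _⟩
  have hf : ∀ y : K → ℝ, f y = ∑ k, y k * f (Pi.single k 1) := by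
    intro y
    conv_lhs => rw [pi_eq_sum_univ' y, map_sum]
    simp
  -- If f y > 0, adding a suitable multiple of y to the all-ones vector gives a point of the open
  -- orthant with value 0, whereas f < c ≤ 0 there.
  have hfcl : ∀ y : K → ℝ, (∀ k, 0 ≤ y k) → f y ≤ 0 := by
    intro y hy
    by_contra! hpos
    have hone := hfs 1 fun k => by simp
    have h1 := hfs (1 + (-(f 1) / f y) • y) fun k => by
      have : 0 ≤ -(f 1) / f y := div_nonneg (by linarith) hpos.le
      simp only [Pi.add_apply, Pi.one_apply, Pi.smul_apply, smul_eq_mul]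
      have := mul_nonneg this (hy k)
      linarith
    rw [map_add, map_smul, smul_eq_mul, div_mul_cancel₀ _ hpos.ne'] at h1
    simp at h1
    have h2 := hfs (1 + (-(f 1) / f y) • y) fun k => by
      have : 0 ≤ -(f 1) / f y := div_nonneg (by linarith) hpos.le
      simp only [Pi.add_apply, Pi.one_apply, Pi.smul_apply, smul_eq_mul]
      have := mul_nonneg this (hy k)
      linarith
    rw [map_add, map_smul, smul_eq_mul, div_mul_cancel₀ _ hpos.ne'] at h2
    linarith
  have hftn : ∀ u : K → ℝ, (∀ k, 0 ≤ u k) → 0 ≤ f (B.mulVec u) := by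
    intro u hu
    by_contra! hneg
    have h1 := hft _ ⟨((c - 1) / f (B.mulVec u)) • u, fun k =>
      mul_nonneg (div_nonneg_of_nonpos (by linarith) hneg.le) (hu k), rfl⟩
    rw [Matrix.mulVecLin_apply, Matrix.mulVec_smul, map_smul, smul_eq_mul,
      div_mul_cancel₀ _ hneg.ne] at h1
    linarith
  refine ⟨fun k => -f (Pi.single k 1), ?_, fun k => ?_, fun k => ?_⟩
  · intro h0
    have h1 := hfs 1 fun k => by simp
    rw [hf] at h1
    have h2 : ∀ k, f (Pi.single k 1) = 0 := fun k => by simpa using congrFun h0 k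
    simp [h2] at h1
    linarith
  · have := hfcl (Pi.single k 1) fun j => by
      rw [Pi.single_apply]; split_ifs <;> norm_num
    linarith
  · have := hftn (Pi.single k 1) fun j => by
      rw [Pi.single_apply]; split_ifs <;> norm_num
    rw [hf] at this
    simp only [Matrix.mulVec_single_one, Matrix.col_apply] at this
    rw [← neg_nonneg, ← Finset.sum_neg_distrib]
    refine this.trans_eq (Finset.sum_congr rfl fun i _ => by ring)

/-- A maximum principle: where a nonnegative vector vanishes, its image is nonpositive because the
off-diagonal entries are. The first consequence is that u is strictly positive. -/
theorem isFiniteType_of_pos {J : Set I} {i : I} (hi : i ∈ J) {K : Set I}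
    (hK : K = A.component J i) (u : K → ℝ) (hu0 : ∀ k, 0 ≤ u k)
    (hu : ∀ k : K, 0 < ∑ᶠ j : K, (A.a k j : ℝ) * u j) : A.IsFiniteType K := by
  classical
  let : Fintype K := Fintype.ofFinite K
  let B : Matrix K K ℝ := Matrix.of fun p q => (A.a p q : ℝ)
  have hu' : ∀ k, 0 < B.mulVec u k := fun k => by
    have := hu k
    rwa [finsum_eq_sum_of_fintype] at this
  have hterm : ∀ (v : K → ℝ), (∀ k, 0 ≤ v k) → ∀ k, v k = 0 → ∀ j : K,
      (A.a k j : ℝ) * v j ≤ 0 := by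
    intro v hv k hk j
    by_cases hkj : k = j
    · subst hkj; simp [hk]
    · have : (A.a k j : ℝ) ≤ 0 := by
        exact_mod_cast A.offDiag k j fun h' => hkj (Subtype.ext h')
      exact mul_nonpos_of_nonpos_of_nonneg this (hv j)
  have hzero : ∀ (v : K → ℝ), (∀ k, 0 ≤ v k) → ∀ k, v k = 0 → B.mulVec v k ≤ 0 :=
    fun v hv k hk => Finset.sum_nonpos fun j _ => hterm v hv k hk j
  have hupos : ∀ k, 0 < u k := fun k => (hu0 k).lt_of_ne' fun h0 =>
    absurd (hzero u hu0 k h0) (not_le.2 (hu' k))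
  have hnonneg : ∀ v : K → ℝ, (∀ k, 0 ≤ B.mulVec v k) → ∀ k, 0 ≤ v k := by
    intro v hv
    have : Nonempty K := ⟨⟨i, hK ▸ mem_component_self J i⟩⟩
    -- If the least ratio v_k/u_k were negative, v - (v_k/u_k)u would be nonnegative with a zero at
    -- k, but with positive image there.
    obtain ⟨k, hk⟩ := Finite.exists_min fun k => v k / u k
    by_contra! hneg
    obtain ⟨j, hj⟩ := hneg
    have hlt : v k / u k < 0 := (hk j).trans_lt (div_neg_of_neg_of_pos hj (hupos j))
    have h1 := hzero (v - (v k / u k) • u) (fun j => by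
      have := (le_div_iff₀ (hupos j)).1 (hk j)
      simp only [Pi.sub_apply, Pi.smul_apply, smul_eq_mul]
      linarith) k (by
      simp only [Pi.sub_apply, Pi.smul_apply, smul_eq_mul]
      rw [div_mul_cancel₀ _ (hupos k).ne', sub_self])
    rw [Matrix.mulVec_sub, Matrix.mulVec_smul] at h1
    simp only [Pi.sub_apply, Pi.smul_apply, smul_eq_mul] at h1
    nlinarith [hv k, hu' k]
  have hpos : ∀ v : K → ℝ, (∀ k, 0 ≤ B.mulVec v k) → (∀ k, 0 < v k) ∨ v = 0 := by
    intro v hv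
    have hv0 := hnonneg v hv
    by_cases hall : ∀ k, 0 < v k
    · exact .inl hall
    · right
      push Not at hall
      obtain ⟨k, hk⟩ := hall
      -- The zero set of v is closed under adjacency: at a zero p all summands of (Bv)_p are
      -- nonpositive, hence all vanish.
      have := component_subset_of_closed (A := A) hi (S := {x | ∃ hx : x ∈ K, v ⟨x, hx⟩ = 0})
        (k := k) ⟨k.2, hk.antisymm (hv0 k)⟩ (hK ▸ k.2) (by
          rintro p ⟨hpK, h1⟩ q hqK hpq
          rw [← hK] at hqK
          have h2 : ∑ j : K, (A.a p j : ℝ) * v j = 0 :=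
            (hzero v hv0 ⟨p, hpK⟩ h1).antisymm (hv ⟨p, hpK⟩)
          have h3 := (Finset.sum_eq_zero_iff_of_nonpos
            (fun j _ => hterm v hv0 ⟨p, hpK⟩ h1 j)).1 h2 ⟨q, hqK⟩ (Finset.mem_univ _)
          rcases mul_eq_zero.1 h3 with h4 | h4
          · exact absurd (by exact_mod_cast h4) hpq
          · exact ⟨hqK, h4⟩)
      exact funext fun x => (this (hK ▸ x.2)).2
  refine ⟨fun hdet => ?_, ⟨u, hupos, hu'⟩, hpos⟩
  obtain ⟨v, hv0, hv⟩ := Matrix.exists_mulVec_eq_zero_iff.2 hdet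
  refine hv0 (funext fun k => le_antisymm ?_ ?_)
  · have := hnonneg (-v) (fun k => by
      rw [Matrix.mulVec_neg]; exact (neg_nonneg.2 (congrFun hv k).le)) k
    simpa using this
  · exact hnonneg v (fun k => (congrFun hv k).ge) k

/-- A component of non-finite type admits a positive vector which is mapped to a nonpositive vector
by the transposed matrix. -/
theorem exists_pos_transpose_nonpos {J : Set I} {i : I} (hi : i ∈ A.inf J) :
    ∃ v : I → ℝ, (∀ k ∈ A.component J i, 0 < v k) ∧ (∀ k ∉ A.component J i, v k = 0) ∧
      ∀ k, ∑ᶠ j, v j * (A.a j k : ℝ) ≤ 0 := by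
  classical
  have : Fintype I := Fintype.ofFinite I
  simp only [finsum_eq_sum_of_fintype]
  set K := A.component J i with hK
  let P : (I → ℝ) → Prop := fun v => v ≠ 0 ∧ (∀ k, 0 ≤ v k) ∧ (∀ k ∉ K, v k = 0) ∧
    ∀ k, ∑ j, v j * (A.a j k : ℝ) ≤ 0
  have hoff : ∀ v : I → ℝ, (∀ k, 0 ≤ v k) → ∀ k, v k = 0 → ∀ j, v j * (A.a j k : ℝ) ≤ 0 := by
    intro v hv k hk j
    by_cases hjk : j = k
    · simp [hjk, hk]
    · exact mul_nonpos_of_nonneg_of_nonpos (hv j) (by exact_mod_cast A.offDiag j k hjk)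
  obtain ⟨v₀, hv₀⟩ : ∃ v, P v := by
    rcases exists_pos_or_exists_transpose_nonpos
      (Matrix.of fun p q : K => (A.a p q : ℝ)) with ⟨u, hu, hu'⟩ | ⟨v, hv0, hv, hv'⟩
    · refine absurd (isFiniteType_of_pos hi.1 hK u hu fun k => ?_) hi.2
      rw [finsum_eq_sum_of_fintype]
      exact hu' k
    · let w : I → ℝ := fun k => if hk : k ∈ K then v ⟨k, hk⟩ else 0
      have hwK : ∀ k : K, w k = v k := fun k => by simp [w]
      have hw0 : ∀ k ∉ K, w k = 0 := fun k hk => by simp [w, hk]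
      have hwn : ∀ k, 0 ≤ w k := fun k => by
        by_cases hk : k ∈ K
        · exact (hwK ⟨k, hk⟩).symm ▸ hv _
        · exact (hw0 k hk).ge
      refine ⟨w, fun h0 => hv0 (funext fun k => ?_), hwn, hw0, fun k => ?_⟩
      · rw [← hwK, h0]; rfl
      · by_cases hk : k ∈ K
        · have h1 := hv' ⟨k, hk⟩
          refine le_of_eq_of_le ?_ h1
          rw [← finsum_eq_sum_of_fintype, ← finsum_eq_sum_of_fintype, ← finsum_mem_univ,
            finsum_mem_inter_support_eq _ Set.univ K (Set.ext fun j => and_congr_left fun hj =>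
              ⟨fun _ => ?_, fun _ => trivial⟩), ← finsum_set_coe_eq_finsum_mem]
          · simp only [hwK, Matrix.of_apply]
          · by_contra hjK
            exact hj (by simp [hw0 j hjK])
        · exact Finset.sum_nonpos fun j _ => hoff w hwn k (hw0 k hk) j
  -- choose a vector with maximal support
  let supp : (I → ℝ) → Finset I := fun v => Finset.univ.filter fun k => v k ≠ 0
  obtain ⟨v, ⟨hv0, hvn, hvK, hvA⟩, hmax⟩ : ∃ v, P v ∧ ∀ w, P w → (supp w).card ≤ (supp v).card := by
    have hbdd : ∃ n, ∀ w, P w → (supp w).card ≤ n := ⟨Fintype.card I, fun w _ => Finset.card_le_univ _⟩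
    have hne : (((fun w => (supp w).card) '' {w | P w}) : Set ℕ).Nonempty := ⟨_, v₀, hv₀, rfl⟩
    obtain ⟨n, hn⟩ := hbdd
    have hfin : (((fun w => (supp w).card) '' {w | P w}) : Set ℕ).Finite :=
      (Set.finite_Iic n).subset (by rintro _ ⟨w, hw, rfl⟩; exact hn w hw)
    obtain ⟨_, ⟨v, hv, rfl⟩, hmax⟩ := Set.exists_max_image _ id hfin hne
    exact ⟨v, hv, fun w hw => hmax _ ⟨w, hw, rfl⟩⟩
  refine ⟨v, ?_, hvK, hvA⟩
  obtain ⟨k₀, hk₀⟩ := Function.ne_iff.1 hv0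
  have hsub := component_subset_of_closed (A := A) hi.1 (S := {k | v k ≠ 0}) (k := k₀) hk₀
    (by by_contra h'; exact hk₀ (hvK _ h')) (by
      intro p hp q hq hpq
      by_contra hvq
      have hvq : v q = 0 := not_not.1 hvq
      have hneg : ∑ j, v j * (A.a j q : ℝ) < 0 := by
        refine Finset.sum_neg' (fun j _ => hoff v hvn q hvq j) ⟨p, Finset.mem_univ p, ?_⟩
        refine mul_neg_of_pos_of_neg ((hvn p).lt_of_ne' hp) ?_
        have h1 : p ≠ q := by rintro rfl; exact hp hvq
        exact_mod_cast (A.offDiag p q h1).lt_of_ne hpq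
      set s := ∑ j, v j * (A.a j q : ℝ) with hs
      -- The diagonal entry is 2, so adding -s/2 > 0 at q moves the entry s of vA at q to exactly 0.
      -- The other entries do not increase, and the support grows.
      let w : I → ℝ := Function.update v q (-s / 2)
      have hwq : w q = -s / 2 := Function.update_self _ _ _
      have hwo : ∀ k ≠ q, w k = v k := fun k hk => Function.update_of_ne hk _ _
      have hwv : w = v + Pi.single q (-s / 2) := by
        ext k
        by_cases hk : k = q
        · subst hk; simp [hwq, hvq]
        · simp [hwo k hk, hk]
      have hws : ∀ k, ∑ j, w j * (A.a j k : ℝ) = ∑ j, v j * (A.a j k : ℝ) + -s / 2 * A.a q k := by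
        intro k
        simp [hwv, add_mul, Finset.sum_add_distrib, Pi.single_apply]
      have hPw : P w := by
        refine ⟨fun h0 => ?_, fun k => ?_, fun k hk => ?_, fun k => ?_⟩
        · have := congrFun h0 q
          rw [hwq] at this
          simp at this
          linarith
        · by_cases hk : k = q
          · subst hk; rw [hwq]; linarith
          · rw [hwo k hk]; exact hvn k
        · rw [hwo k (by rintro rfl; exact hk hq)]; exact hvK k hk
        · rw [hws]
          by_cases hk : k = q
          · subst hk
            rw [A.diag, ← hs]
            push_cast
            linarith
          · have h1 : (A.a q k : ℝ) ≤ 0 := by exact_mod_cast A.offDiag q k (Ne.symm hk)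
            have := hvA k
            nlinarith
      refine absurd (hmax w hPw) (not_le.2 (Finset.card_lt_card ?_))
      refine Finset.ssubset_iff_of_subset (fun k hk => ?_) |>.2 ⟨q, ?_, ?_⟩
      · simp only [supp, Finset.mem_filter, Finset.mem_univ, true_and] at hk ⊢
        rwa [hwo k (by rintro rfl; exact hk hvq)]
      · simp only [supp, Finset.mem_filter, Finset.mem_univ, true_and]
        rw [hwq]
        linarith
      · simp [supp, hvq])
  exact fun k hk => (hvn k).lt_of_ne' (hsub hk)

/-- A special set admits a positive vector which is mapped to a nonpositive vector by the transposed
matrix. -/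
theorem IsSpecial.exists_pos_transpose_nonpos {Θ : Set I} (hΘ : A.IsSpecial Θ) :
    ∃ v : I → ℝ, (∀ k ∈ Θ, 0 < v k) ∧ (∀ k ∉ Θ, v k = 0) ∧
      ∀ k, ∑ᶠ j, v j * (A.a j k : ℝ) ≤ 0 := by
  classical
  have : Fintype I := Fintype.ofFinite I
  have hex : ∀ i : Θ, ∃ v : I → ℝ, (∀ k ∈ A.component Θ i, 0 < v k) ∧
      (∀ k ∉ A.component Θ i, v k = 0) ∧ ∀ k, ∑ j, v j * (A.a j k : ℝ) ≤ 0 := by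
    intro i
    obtain ⟨v, h1, h2, h3⟩ := A.exists_pos_transpose_nonpos (J := Θ) (i := i)
      (by have := i.2; rwa [← hΘ])
    exact ⟨v, h1, h2, by simpa only [finsum_eq_sum_of_fintype] using h3⟩
  choose V hV1 hV2 hV3 using hex
  have hVn : ∀ i k, 0 ≤ V i k := fun i k => by
    by_cases hk : k ∈ A.component Θ i
    · exact (hV1 i k hk).le
    · exact (hV2 i k hk).ge
  simp only [finsum_eq_sum_of_fintype]
  refine ⟨fun k => ∑ i : Θ, V i k, fun k hk => ?_, fun k hk => ?_, fun k => ?_⟩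
  · exact Finset.sum_pos' (fun i _ => hVn i k)
      ⟨⟨k, hk⟩, Finset.mem_univ _, hV1 _ _ (mem_component_self Θ k)⟩
  · exact Finset.sum_eq_zero fun i _ => hV2 i k fun h' => hk (component_subset i.2 h')
  · simp only [Finset.sum_mul]
    rw [Finset.sum_comm]
    exact Finset.sum_nonpos fun i _ => hV3 i k

end GCM

namespace Realization

variable {I : Type*} {A : GCM I} {h : Type*} [AddCommGroup h] [Module ℝ h] (ρ : Realization A h)

/-! ### Faces and closed facets -/

theorem exists_add_smul_mem_chamber [Finite I] {f y : Module.Dual ℝ h}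
    (hfy : ∀ i, 0 < f (ρ.coroot i) ∨ 0 ≤ f (ρ.coroot i) ∧ 0 ≤ y (ρ.coroot i)) :
    ∃ ε : ℝ, 0 < ε ∧ f + ε • y ∈ ρ.chamber := by
  have := Fintype.ofFinite I
  have hf : ∀ i, 0 ≤ f (ρ.coroot i) := fun i => (hfy i).elim le_of_lt And.left
  have hterm : ∀ i, 0 ≤ |y (ρ.coroot i)| / f (ρ.coroot i) :=
    fun i => div_nonneg (abs_nonneg _) (hf i)
  have hsum := Finset.sum_nonneg fun i (_ : i ∈ Finset.univ) => hterm i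
  -- Summands with f(h_i) = 0 are 0 by the convention for division; no bound is needed there, since
  -- y(h_i) ≥ 0.
  set t := ∑ i, |y (ρ.coroot i)| / f (ρ.coroot i) with ht
  have ht1 : 0 < 1 + t := by linarith
  refine ⟨(1 + t)⁻¹, inv_pos.2 ht1, fun i => ?_⟩
  simp only [LinearMap.add_apply, LinearMap.smul_apply, smul_eq_mul]
  rcases hfy i with hi | ⟨hi, hi'⟩
  · have h1 : |y (ρ.coroot i)| / f (ρ.coroot i) ≤ t :=
      Finset.single_le_sum (fun j _ => hterm j) (Finset.mem_univ i)
    rw [div_le_iff₀ hi] at h1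
    have h2 : 0 ≤ (1 + t) * f (ρ.coroot i) + y (ρ.coroot i) := by
      linarith [neg_abs_le (y (ρ.coroot i))]
    have h3 := mul_nonneg (inv_pos.2 ht1).le h2
    rwa [mul_add, inv_mul_cancel_left₀ ht1.ne'] at h3
  · exact add_nonneg hi (mul_nonneg (inv_pos.2 ht1).le hi')

variable {ρ}

theorem Face.mem_titsCone (R : ρ.Face) {l : Module.Dual ℝ h} (hl : l ∈ R.carrier) :
    l ∈ ρ.titsCone := R.2.le hl

/-- If a face contains an element `f`, and `f` can be moved inside the Tits cone a bit in the
direction `-x`, then the face contains `x`. -/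
theorem Face.mem_of_add_smul_neg_mem (R : ρ.Face) {f x : Module.Dual ℝ h} (hf : f ∈ R.carrier)
    (hx : x ∈ ρ.titsCone) {ε : ℝ} (hε : 0 < ε) (hfx : f + ε • -x ∈ ρ.titsCone) :
    x ∈ R.carrier :=
  R.2.mem_of_smul_add_mem hx hfx hε (by
    have : ε • x + (f + ε • -x) = f := by module
    rw [this]; exact hf)

/-- J' collects the indices at which the whole intersection vanishes. Adding one witness for each
other index gives a point of R in the relative interior of F̄_{J'}. From it one can move a little in
the direction -x for any x in F̄_{J'}, so the face property puts x into R. -/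
theorem Face.exists_inter_closedFacet [Finite I] (R : ρ.Face) (J : Set I) :
    ∃ J' : Set I, R.carrier ∩ ρ.closedFacet J = ρ.closedFacet J' := by
  classical
  have := Fintype.ofFinite I
  let J' : Set I := {i | ∀ l ∈ R.carrier ∩ ρ.closedFacet J, l (ρ.coroot i) = 0}
  have hC : ∀ l ∈ R.carrier ∩ ρ.closedFacet J, l ∈ ρ.chamber :=
    fun l hl => ρ.closedFacet_subset_chamber J hl.2
  have hJ : J ⊆ J' := fun i hi l hl => hl.2.1 i hi
  refine ⟨J', Set.Subset.antisymm (fun l hl => ⟨fun i hi => hi l hl, fun i _ => hC l hl i⟩)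
    fun x hx => ⟨?_, ?_⟩⟩
  · have hg : ∀ i, ∃ l ∈ R.carrier ∩ ρ.closedFacet J, i ∉ J' → 0 < l (ρ.coroot i) := by
      intro i
      by_cases hi : i ∈ J'
      · exact ⟨0, ⟨zero_mem R.1, by simp [closedFacet]⟩, fun h' => absurd hi h'⟩
      · have hi' : ¬ ∀ l ∈ R.carrier ∩ ρ.closedFacet J, l (ρ.coroot i) = 0 := hi
        push Not at hi'
        obtain ⟨l, hl, hli⟩ := hi'
        exact ⟨l, hl, fun _ => (hC l hl i).lt_of_ne' hli⟩
    choose g hg hgpos using hg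
    obtain ⟨ε, hε, hmem⟩ := ρ.exists_add_smul_mem_chamber (f := ∑ i, g i) (y := -x) (fun i => by
      rw [LinearMap.sum_apply, LinearMap.neg_apply]
      by_cases hi : i ∈ J'
      · exact .inr ⟨Finset.sum_nonneg fun k _ => hC _ (hg k) i, by simp [hx.1 i hi]⟩
      · exact .inl (Finset.sum_pos' (fun k _ => hC _ (hg k) i) ⟨i, Finset.mem_univ i, hgpos i hi⟩))
    exact R.mem_of_add_smul_neg_mem (Submodule.sum_mem R.1 fun i _ => (hg i).1)
      (ρ.chamber_subset_titsCone (ρ.closedFacet_subset_chamber J' hx)) hε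
      (ρ.chamber_subset_titsCone hmem)
  · exact ⟨fun i hi => hx.1 i (hJ hi), fun i _ => ρ.closedFacet_subset_chamber J' hx i⟩

theorem Face.exists_inter_smul_closedFacet [Finite I] (R : ρ.Face) (w : ρ.weyl) (J : Set I) :
    ∃ J' : Set I, R.carrier ∩ w • ρ.closedFacet J = w • ρ.closedFacet J' := by
  obtain ⟨J', hJ'⟩ := (R.translateInv w).exists_inter_closedFacet J
  refine ⟨J', ?_⟩
  rw [← hJ', Face.carrier_translateInv, Set.smul_set_inter, smul_inv_smul]

variable (ρ)

/-! ### The special faces -/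

theorem parabolic_perp_smul_apply {Θ : Set I} {w : ρ.weyl} (hw : w ∈ ρ.parabolic (A.perp Θ))
    (f : Module.Dual ℝ h) {i : I} (hi : i ∈ Θ) : (w • f) (ρ.coroot i) = f (ρ.coroot i) := by
  obtain ⟨L, hL, rfl⟩ := ρ.exists_wordProd_of_mem_parabolic hw
  clear hw
  induction L with
  | nil => simp
  | cons k L ih =>
    rw [wordProd_cons, mul_smul, simple_smul_apply, ih fun j hj => hL j (by simp [hj]),
      (A.zero_iff i k).2 (hL k (by simp) i hi)]
    simp

theorem mem_specialSet {Θ : Set I} {l : Module.Dual ℝ h} :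
    l ∈ ρ.specialSet Θ ↔ ∃ w ∈ ρ.parabolic (A.perp Θ), ∃ f ∈ ρ.closedFacet Θ, l = w • f := by
  simp only [specialSet, Set.mem_iUnion, Set.mem_smul_set, exists_prop, eq_comm]

theorem closedFacet_subset_specialSet (Θ : Set I) : ρ.closedFacet Θ ⊆ ρ.specialSet Θ :=
  fun f hf => ρ.mem_specialSet.2 ⟨1, one_mem _, f, hf, (one_smul _ _).symm⟩

theorem smul_mem_specialSet {Θ : Set I} {w : ρ.weyl} (hw : w ∈ ρ.parabolic (A.perp Θ))
    {l : Module.Dual ℝ h} (hl : l ∈ ρ.specialSet Θ) : w • l ∈ ρ.specialSet Θ := by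
  obtain ⟨v, hv, f, hf, rfl⟩ := ρ.mem_specialSet.1 hl
  exact ρ.mem_specialSet.2 ⟨w * v, mul_mem hw hv, f, hf, (mul_smul _ _ _).symm⟩

theorem specialSet_apply_eq_zero {Θ : Set I} {l : Module.Dual ℝ h} (hl : l ∈ ρ.specialSet Θ) {i : I}
    (hi : i ∈ Θ) : l (ρ.coroot i) = 0 := by
  obtain ⟨w, hw, f, hf, rfl⟩ := ρ.mem_specialSet.1 hl
  rw [ρ.parabolic_perp_smul_apply hw f hi]
  exact hf.1 i hi

theorem mem_titsCone_of_mem_specialSet {Θ : Set I} {l : Module.Dual ℝ h}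
    (hl : l ∈ ρ.specialSet Θ) : l ∈ ρ.titsCone := by
  obtain ⟨w, -, f, hf, rfl⟩ := ρ.mem_specialSet.1 hl
  exact ρ.smul_mem_titsCone w (ρ.chamber_subset_titsCone (ρ.closedFacet_subset_chamber Θ hf))

theorem eq_zero_of_sum_eq_zero {Θ : Set I} [Fintype I] {v : I → ℝ} (hv : ∀ k ∈ Θ, 0 < v k)
    (hv0 : ∀ k ∉ Θ, v k = 0) {g : I → ℝ} (hg : ∀ k, 0 ≤ g k) (hs : ∑ k, v k * g k = 0) :
    ∀ k ∈ Θ, g k = 0 := by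
  intro k hk
  have hvn : ∀ k, 0 ≤ v k := fun k => by
    by_cases hk : k ∈ Θ
    · exact (hv k hk).le
    · exact (hv0 k hk).ge
  have := (Finset.sum_eq_zero_iff_of_nonneg fun k _ => mul_nonneg (hvn k) (hg k)).1 hs k
    (Finset.mem_univ k)
  exact (mul_eq_zero.1 this).resolve_left (hv k hk).ne'

/-- The set `R(Θ)` is cut out of the Tits cone by a supporting hyperplane. -/
theorem exists_supporting [Finite I] {Θ : Set I} (hΘ : A.IsSpecial Θ) : ∃ β : h,
    (∀ l ∈ ρ.titsCone, 0 ≤ l β) ∧ ∀ l, l ∈ ρ.specialSet Θ ↔ l ∈ ρ.titsCone ∧ l β = 0 := by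
  have := Fintype.ofFinite I
  obtain ⟨v, hv, hv0, hvA⟩ := hΘ.exists_pos_transpose_nonpos
  simp only [finsum_eq_sum_of_fintype] at hvA
  have hvn : ∀ k, 0 ≤ v k := fun k => by
    by_cases hk : k ∈ Θ
    · exact (hv k hk).le
    · exact (hv0 k hk).ge
  -- The k-th entry of vA is α_k(β), so every simple root is nonpositive on β and values at β cannot
  -- decrease along a reduced word.
  set β : h := ∑ k, v k • ρ.coroot k with hβ
  have hlβ : ∀ l : Module.Dual ℝ h, l β = ∑ k, v k * l (ρ.coroot k) := fun l => by simp [hβ]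
  have hroot : ∀ k, ρ.root k β ≤ 0 := fun k => by
    rw [hlβ]; simpa only [ρ.root_coroot] using hvA k
  have hperp : ∀ k ∉ Θ, ρ.root k β = 0 → k ∈ A.perp Θ := by
    intro k hk h0
    rw [hlβ, ← neg_eq_zero, ← Finset.sum_neg_distrib] at h0
    simp only [ρ.root_coroot, ← mul_neg] at h0
    by_contra hk'
    have hk' : ¬ ∀ j ∈ Θ, A.a k j = 0 := hk'
    push Not at hk'
    obtain ⟨j, hj, hkj⟩ := hk'
    have h1 : ∀ i, 0 ≤ v i * -(A.a i k : ℝ) := by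
      intro i
      by_cases hi : i = k
      · subst hi; simp [hv0 i hk]
      · have : (A.a i k : ℝ) ≤ 0 := by exact_mod_cast A.offDiag i k hi
        exact mul_nonneg (hvn i) (by linarith)
    have h2 := (Finset.sum_eq_zero_iff_of_nonneg fun i _ => h1 i).1 h0 j (Finset.mem_univ j)
    rcases mul_eq_zero.1 h2 with h3 | h3
    · exact (hv j hj).ne' h3
    · exact A.ne_zero_symm hkj (by exact_mod_cast neg_eq_zero.1 h3)
  have key : ∀ L : List I, L.length = ρ.length (ρ.wordProd L) → ∀ c ∈ ρ.chamber,
      0 ≤ (ρ.wordProd L • c) β ∧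
        ((ρ.wordProd L • c) β = 0 → ρ.wordProd L • c ∈ ρ.specialSet Θ) := by
    intro L hL c hc
    induction L with
    | nil =>
      rw [wordProd_nil, one_smul]
      refine ⟨?_, fun h0 => ρ.closedFacet_subset_specialSet Θ ⟨?_, fun i _ => hc i⟩⟩
      · rw [hlβ]
        exact Finset.sum_nonneg fun k _ => mul_nonneg (hvn k) (hc k)
      · rw [hlβ] at h0
        exact eq_zero_of_sum_eq_zero hv hv0 hc h0
    | cons i L ih =>
      obtain ⟨hl1, hl2⟩ := ρ.reduced_tail rfl hL
      obtain ⟨ih1, ih2⟩ := ih hl1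
      have h1 := ρ.smul_apply_coroot_nonneg hc hl2
      rw [wordProd_cons, mul_smul]
      generalize ρ.wordProd L • c = l at ih1 ih2 h1
      have h2 : (ρ.simple i • l) β = l β - l (ρ.coroot i) * ρ.root i β := by
        rw [simple_smul]; rfl
      have h3 : l (ρ.coroot i) * ρ.root i β ≤ 0 :=
        mul_nonpos_of_nonneg_of_nonpos h1 (hroot i)
      refine ⟨by linarith, fun h0 => ?_⟩
      have h4 := ih2 (by linarith)
      have h5 : l (ρ.coroot i) * ρ.root i β = 0 := by linarith
      -- If the value at β stays 0 although s_i moves l, then α_i(β) = 0 and i lies outside Θ. This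
      -- forces i ∈ Θ^⊥, so s_i preserves R(Θ).
      by_cases hli : l (ρ.coroot i) = 0
      · rwa [ρ.simple_smul_eq_self hli]
      · have hi : i ∉ Θ := fun hi => hli (ρ.specialSet_apply_eq_zero h4 hi)
        exact ρ.smul_mem_specialSet (ρ.simple_mem_parabolic
          (hperp i hi ((mul_eq_zero.1 h5).resolve_left hli))) h4
  have hred : ∀ l ∈ ρ.titsCone, ∃ L : List I, L.length = ρ.length (ρ.wordProd L) ∧
      ∃ c ∈ ρ.chamber, l = ρ.wordProd L • c := by
    intro l hl
    obtain ⟨w, c, hc, rfl⟩ := ρ.mem_titsCone.1 hl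
    obtain ⟨L, rfl, hL⟩ := ρ.exists_reduced w
    exact ⟨L, hL, c, hc, rfl⟩
  refine ⟨β, fun l hl => ?_, fun l => ⟨fun hl => ⟨ρ.mem_titsCone_of_mem_specialSet hl, ?_⟩,
    fun ⟨hl, h0⟩ => ?_⟩⟩
  · obtain ⟨L, hL, c, hc, rfl⟩ := hred l hl
    exact (key L hL c hc).1
  · rw [hlβ]
    refine Finset.sum_eq_zero fun k _ => ?_
    by_cases hk : k ∈ Θ
    · rw [ρ.specialSet_apply_eq_zero hl hk, mul_zero]
    · rw [hv0 k hk, zero_mul]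
  · obtain ⟨L, hL, c, hc, rfl⟩ := hred l hl
    exact (key L hL c hc).2 h0

theorem exists_face_specialSet [Finite I] {Θ : Set I} (hΘ : A.IsSpecial Θ) :
    ∃ R : ρ.Face, R.carrier = ρ.specialSet Θ := by
  obtain ⟨β, hβ, hβΘ⟩ := ρ.exists_supporting hΘ
  refine ⟨⟨ρ.titsCone ⊓ PointedCone.ofSubmodule (LinearMap.ker (Module.Dual.eval ℝ h β)),
    inf_le_left, ?_⟩, Set.ext fun l => ((hβΘ l).trans ?_).symm⟩
  · rintro x y a hx hy ha ⟨-, h0⟩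
    refine ⟨hx, ?_⟩
    have h0 : (a • x + y) β = 0 := h0
    have h1 : a * x β + y β = 0 := h0
    have h2 := mul_nonneg ha.le (hβ x hx)
    have h3 := hβ y hy
    exact (mul_eq_zero.1 (by linarith : a * x β = 0)).resolve_left ha.ne'
  · rfl

/-- A face which contains an element of the relative interior of the closed facet of type `J`
contains `R(J^∞)`. -/
theorem specialSet_inf_subset [Finite I] (R : ρ.Face) {J : Set I} {f : Module.Dual ℝ h}
    (hf : f ∈ R.carrier) (hf0 : ∀ i ∈ J, f (ρ.coroot i) = 0) (hfpos : ∀ i ∉ J, 0 < f (ρ.coroot i)) :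
    ρ.specialSet (A.inf J) ⊆ R.carrier := by
  intro x hx
  obtain ⟨u, hu, hu'⟩ := A.exists_pos_of_diff_inf J
  -- On J \ J^∞, of finite type, -x is made dominant by w. Since w lies in the parabolic subgroup of
  -- (J^∞)^⊥, the zero values on J^∞ persist. As w also fixes f, moving from f towards -x stays in
  -- the Tits cone.
  obtain ⟨w, hw, hdom⟩ := ρ.exists_parabolic_dominant u hu hu' (-x)
  obtain ⟨ε, hε, hmem⟩ := ρ.exists_add_smul_mem_chamber (f := f) (y := w • -x) (fun i => by
    by_cases hi : i ∈ J
    · refine .inr ⟨(hf0 i hi).ge, ?_⟩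
      by_cases hi' : i ∈ A.inf J
      · rw [ρ.parabolic_perp_smul_apply (ρ.parabolic_mono (A.diff_inf_subset_perp J) hw) _ hi',
          LinearMap.neg_apply, ρ.specialSet_apply_eq_zero hx hi', neg_zero]
      · exact hdom i ⟨hi, hi'⟩
    · exact .inl (hfpos i hi))
  refine R.mem_of_add_smul_neg_mem hf (ρ.mem_titsCone_of_mem_specialSet hx) hε ?_
  have h1 := ρ.smul_mem_titsCone w⁻¹ (ρ.chamber_subset_titsCone hmem)
  rwa [smul_add, weyl_smul_smul, inv_smul_smul,
    ρ.parabolic_smul_eq (inv_mem hw) fun i hi => hf0 i hi.1] at h1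

/-- Every face of the Tits cone is a translate of a special face. -/
theorem exists_carrier_eq_smul_specialSet [Finite I] [FiniteDimensional ℝ h] (R : ρ.Face) :
    ∃ (w : ρ.weyl) (Θ : Set I), A.IsSpecial Θ ∧ R.carrier = w • ρ.specialSet Θ := by
  obtain ⟨S, hSR, hS⟩ := Submodule.fg_span_iff_fg_span_finset_subset R.carrier |>.1
    (IsNoetherian.noetherian (Submodule.span ℝ R.carrier))
  -- The sum of a spanning set serves as a relative interior point of R: a linear form nonnegative
  -- on R which vanishes there vanishes on all of R.
  have hsum : ∑ s ∈ S, s ∈ R.carrier := Submodule.sum_mem R.1 fun s hs => hSR hs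
  obtain ⟨w, c, hc, hwc⟩ := ρ.mem_titsCone.1 (R.mem_titsCone hsum)
  set Θ := A.inf {i | c (ρ.coroot i) = 0} with hΘ
  have hsp : A.IsSpecial Θ := GCM.isSpecial_inf _
  obtain ⟨β, hβ, hβΘ⟩ := ρ.exists_supporting hsp
  have hcR : c ∈ (R.translateInv w).carrier := by
    rw [Face.carrier_translateInv, Set.mem_inv_smul_set_iff, ← hwc]
    exact hsum
  have hsub := ρ.specialSet_inf_subset (R.translateInv w) (J := {i | c (ρ.coroot i) = 0}) hcR
    (fun i hi => hi) (fun i hi => (hc i).lt_of_ne' hi)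
  have hcΘ : c ∈ ρ.specialSet Θ := ρ.closedFacet_subset_specialSet Θ
    ⟨fun i hi => GCM.inf_subset {i | c (ρ.coroot i) = 0} hi, fun i _ => hc i⟩
  have hcβ : ∑ s ∈ S, (w⁻¹ • s) β = 0 := by
    rw [← LinearMap.sum_apply, ← weyl_smul_sum, hwc, inv_smul_smul]
    exact ((hβΘ c).1 hcΘ).2
  have hzero : ∀ s ∈ S, (w⁻¹ • s) β = 0 := (Finset.sum_eq_zero_iff_of_nonneg fun s hs =>
    hβ _ (ρ.smul_mem_titsCone _ (R.mem_titsCone (hSR hs)))).1 hcβ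
  refine ⟨w, Θ, hsp, Set.Subset.antisymm (fun x hx => ?_) ?_⟩
  · rw [Set.mem_smul_set_iff_inv_smul_mem, hβΘ]
    refine ⟨ρ.smul_mem_titsCone _ (R.mem_titsCone hx), ?_⟩
    have hxS : x ∈ Submodule.span ℝ (S : Set (Module.Dual ℝ h)) :=
      hS ▸ Submodule.subset_span hx
    have : Submodule.span ℝ (S : Set (Module.Dual ℝ h)) ≤
        LinearMap.ker (Module.Dual.eval ℝ h β ∘ₗ ρ.act w⁻¹) :=
      Submodule.span_le.2 fun s hs => hzero s hs
    exact this hxS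
  · rw [Face.carrier_translateInv] at hsub
    rwa [Set.smul_set_subset_iff_subset_inv_smul_set]

/-! ### The Coxeter complex and the closed facets -/

theorem closedFacet_anti {J K : Set I} (hJK : J ⊆ K) : ρ.closedFacet K ⊆ ρ.closedFacet J :=
  fun _ hf => ⟨fun i hi => hf.1 i (hJK hi), fun i _ => ρ.closedFacet_subset_chamber K hf i⟩

theorem parabolic_smul_closedFacet {J : Set I} {w : ρ.weyl} (hw : w ∈ ρ.parabolic J) :
    w • ρ.closedFacet J = ρ.closedFacet J := by
  ext l
  rw [Set.mem_smul_set_iff_inv_smul_mem]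
  refine ⟨fun hl => ?_, fun hl => ?_⟩
  · have := ρ.parabolic_smul_eq hw hl.1
    rw [smul_inv_smul] at this
    rwa [← this] at hl
  · rwa [ρ.parabolic_smul_eq (inv_mem hw) hl.1]

/-- A generic point of F̄_J vanishes exactly at J and has stabilizer W_J, so the claim follows from
`eq_of_chamber` at this one point. -/
theorem of_smul_closedFacet_subset {τ τ' : ρ.weyl} {J J' : Set I}
    (hsub : τ • ρ.closedFacet J ⊆ τ' • ρ.closedFacet J') :
    J' ⊆ J ∧ τ'⁻¹ * τ ∈ ρ.parabolic J := by
  obtain ⟨f, hf, hf'⟩ := ρ.exists_generic J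
  have hfJ : f ∈ ρ.closedFacet J := ⟨hf, fun i hi => (hf' i hi).le⟩
  obtain ⟨g, hg, hgf⟩ := Set.mem_smul_set.1 (hsub (Set.smul_mem_smul_set hfJ))
  obtain ⟨h1, h2⟩ := ρ.eq_of_chamber (ρ.closedFacet_subset_chamber J hfJ)
    (ρ.closedFacet_subset_chamber J' hg) (w := τ'⁻¹ * τ) (by
      rw [mul_smul, ← hgf, inv_smul_smul])
  have hJ : ∀ i, f (ρ.coroot i) = 0 → i ∈ J := fun i hi => by
    by_contra h'
    exact (hf' i h').ne' hi
  refine ⟨fun i hi => hJ i ?_, ρ.parabolic_mono (fun i hi => hJ i hi) h2⟩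
  rw [h1]
  exact hg.1 i hi

theorem mem_of_simple_mem_parabolic {i : I} {J : Set I} (hi : ρ.simple i ∈ ρ.parabolic J) :
    i ∈ J := by
  obtain ⟨f, hf, hf'⟩ := ρ.exists_generic J
  by_contra hiJ
  have h1 := ρ.simple_smul_apply_self i f
  rw [ρ.parabolic_smul_eq hi hf] at h1
  have := hf' i hiJ
  linarith

theorem smul_closedFacet_subset_iff {τ τ' : ρ.weyl} {J J' : Set I} :
    τ • ρ.closedFacet J ⊆ τ' • ρ.closedFacet J' ↔
      τ' • (ρ.parabolic J' : Set ρ.weyl) ⊆ τ • (ρ.parabolic J : Set ρ.weyl) := by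
  constructor
  · intro hsub
    obtain ⟨h1, h2⟩ := ρ.of_smul_closedFacet_subset hsub
    rintro _ ⟨u, hu, rfl⟩
    refine Set.mem_smul_set_iff_inv_smul_mem.2 ?_
    have := mul_mem (inv_mem h2) (ρ.parabolic_mono h1 hu)
    simpa [mul_assoc] using this
  · intro hsub
    have h1 : τ⁻¹ * τ' ∈ ρ.parabolic J := by
      have := hsub (Set.smul_mem_smul_set (one_mem (ρ.parabolic J')))
      simpa [Set.mem_smul_set_iff_inv_smul_mem] using this
    have h2 : J' ⊆ J := fun i hi => by
      have := hsub (Set.smul_mem_smul_set (ρ.simple_mem_parabolic hi))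
      rw [Set.mem_smul_set_iff_inv_smul_mem, smul_eq_mul, smul_eq_mul, ← mul_assoc] at this
      exact ρ.mem_of_simple_mem_parabolic ((Subgroup.mul_mem_cancel_left _ h1).1 this)
    have h3 : τ' = τ * (τ⁻¹ * τ') := by group
    rw [← ρ.parabolic_smul_closedFacet h1, ← mul_smul, ← h3]
    exact Set.smul_set_mono (ρ.closedFacet_anti h2)

variable {ρ} in
theorem Complex.eq_coset (S : ρ.Complex) : ∃ (τ : ρ.weyl) (J : Set I), S = ρ.coset τ J :=
  let ⟨τ, J, hS⟩ := S.2
  ⟨τ, J, Subtype.ext hS⟩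

theorem facet_le_iff {τ τ' : ρ.weyl} {J J' : Set I} :
    ρ.facet τ J ≤ ρ.facet τ' J' ↔ ρ.coset τ J ≤ ρ.coset τ' J' :=
  ρ.smul_closedFacet_subset_iff

theorem facet_eq_iff {τ τ' : ρ.weyl} {J J' : Set I} :
    ρ.facet τ J = ρ.facet τ' J' ↔ ρ.coset τ J = ρ.coset τ' J' := by
  rw [le_antisymm_iff, le_antisymm_iff, facet_le_iff, facet_le_iff]

/-- The closed facet which corresponds to a coset. -/
noncomputable def complexToFacet (S : ρ.Complex) : ρ.Facet :=
  ρ.facet S.eq_coset.choose S.eq_coset.choose_spec.choose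

theorem complexToFacet_coset (τ : ρ.weyl) (J : Set I) :
    ρ.complexToFacet (ρ.coset τ J) = ρ.facet τ J :=
  ρ.facet_eq_iff.2 (ρ.coset τ J).eq_coset.choose_spec.choose_spec.symm

/-- The identification of the Coxeter complex with the set of closed facets. -/
noncomputable def complexIso : ρ.Complex ≃o ρ.Facet :=
  RelIso.ofSurjective
    (OrderEmbedding.ofMapLEIff ρ.complexToFacet fun S T => by
      obtain ⟨τ, J, rfl⟩ := S.eq_coset
      obtain ⟨τ', J', rfl⟩ := T.eq_coset
      rw [complexToFacet_coset, complexToFacet_coset, facet_le_iff])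
    (by
      rintro ⟨_, τ, J, rfl⟩
      exact ⟨ρ.coset τ J, ρ.complexToFacet_coset τ J⟩)

theorem complexIso_coset (τ : ρ.weyl) (J : Set I) : ρ.complexIso (ρ.coset τ J) = ρ.facet τ J :=
  ρ.complexToFacet_coset τ J

/-! ### The action of the face monoid -/

variable {ρ} in
theorem cls_eq_unit_mul_idem (σ : ρ.weyl) (R : ρ.Face) : cls σ R = unit σ * idem R := by
  have : (⟨σ, R⟩ : ρ.Pair) = ⟨σ, ρ.topFace⟩ * ⟨1, R⟩ := by
    refine Pair.ext (mul_one σ).symm (Face.ext (Set.ext fun l => ?_))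
    rw [Pair.mem_mul_face]
    exact ⟨fun hl => ⟨ρ.smul_mem_titsCone 1 (R.mem_titsCone hl), hl⟩, And.right⟩
  exact congrArg (fun p : ρ.Pair => (p : ρ.con.Quotient)) this

variable {ρ} in
theorem cls_mul_unit (σ τ : ρ.weyl) (R : ρ.Face) :
    cls σ R * unit τ = cls (σ * τ) (R.translateInv τ) := by
  have : (⟨σ, R⟩ : ρ.Pair) * ⟨τ, ρ.topFace⟩ = ⟨σ * τ, R.translateInv τ⟩ := by
    refine Pair.ext rfl (Face.ext (Set.ext fun l => ?_))
    rw [Pair.mem_mul_face]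
    exact ⟨And.left, fun hl => ⟨hl, (R.translateInv τ).mem_titsCone hl⟩⟩
  exact congrArg (fun p : ρ.Pair => (p : ρ.con.Quotient)) this

theorem smul_closedFacet_subset_titsCone (τ : ρ.weyl) (J : Set I) :
    τ • ρ.closedFacet J ⊆ (ρ.titsCone : Set (Module.Dual ℝ h)) := by
  rintro _ ⟨f, hf, rfl⟩
  exact ρ.smul_mem_titsCone τ (ρ.chamber_subset_titsCone (ρ.closedFacet_subset_chamber J hf))

variable {ρ} in
theorem WHat.exists_cls (m : ρ.WHat) : ∃ (σ : ρ.weyl) (R : ρ.Face), m = cls σ R := by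
  induction m using Con.induction_on with
  | H p => exact ⟨p.elt, p.face, rfl⟩

variable [Finite I]

/-- The action of the semidirect product on the closed facets. -/
def pairAction : ρ.Pair →* Function.End ρ.Facet where
  toFun p F := ⟨p.elt • (p.face.carrier ∩ F.1), by
    obtain ⟨_, τ, J, rfl⟩ := F
    obtain ⟨J', hJ'⟩ := p.face.exists_inter_smul_closedFacet τ J
    exact ⟨p.elt * τ, J', by rw [hJ', mul_smul]⟩⟩
  map_one' := by
    funext F
    refine Subtype.ext ?_
    obtain ⟨_, τ, J, rfl⟩ := F
    exact (one_smul _ _).trans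
      (Set.inter_eq_self_of_subset_right (ρ.smul_closedFacet_subset_titsCone τ J))
  map_mul' p q := by
    funext F
    refine Subtype.ext ?_
    change (p.elt * q.elt) • ((p * q).face.carrier ∩ F.1) =
      p.elt • (p.face.carrier ∩ q.elt • (q.face.carrier ∩ F.1))
    rw [mul_smul]
    congr 1
    ext l
    rw [Set.mem_smul_set_iff_inv_smul_mem, Set.mem_inter_iff, Set.mem_inter_iff,
      Set.mem_smul_set_iff_inv_smul_mem, Pair.mem_mul_face, smul_inv_smul, Set.mem_inter_iff,
      and_assoc]

/-- The action of the face monoid on the closed facets. -/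
def facetAction : ρ.WHat →* Function.End ρ.Facet :=
  ρ.con.lift ρ.pairAction fun p q hpq => by
    obtain ⟨h1, h2⟩ := hpq
    funext F
    refine Subtype.ext ?_
    change p.elt • (p.face.carrier ∩ F.1) = q.elt • (q.face.carrier ∩ F.1)
    rw [← h1]
    refine Set.image_congr fun l hl => ?_
    have := h2 l hl.1
    rw [mul_smul, inv_smul_eq_iff] at this
    exact this.symm

theorem facetAction_cls (σ : ρ.weyl) (R : ρ.Face) (F : ρ.Facet) :
    (ρ.facetAction (cls σ R) F).1 = σ • (R.carrier ∩ F.1) := rfl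

/-- The action of the face monoid on the Coxeter complex. -/
@[reducible] noncomputable def complexAction : MulAction ρ.WHat ρ.Complex where
  smul m c := ρ.complexIso.symm (ρ.facetAction m (ρ.complexIso c))
  one_smul c := by
    change ρ.complexIso.symm (ρ.facetAction 1 (ρ.complexIso c)) = c
    rw [map_one]
    exact ρ.complexIso.symm_apply_apply c
  mul_smul m n c := by
    change ρ.complexIso.symm (ρ.facetAction (m * n) (ρ.complexIso c)) =
      ρ.complexIso.symm (ρ.facetAction m
        (ρ.complexIso (ρ.complexIso.symm (ρ.facetAction n (ρ.complexIso c)))))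
    rw [map_mul, OrderIso.apply_symm_apply]
    rfl

-- Faithfulness and goodness of the action.

attribute [local instance] complexAction

theorem complexIso_smul (m : ρ.WHat) (c : ρ.Complex) :
    ρ.complexIso (m • c) = ρ.facetAction m (ρ.complexIso c) :=
  ρ.complexIso.apply_symm_apply _

theorem complexIso_cls_smul (σ : ρ.weyl) (R : ρ.Face) (c : ρ.Complex) :
    (ρ.complexIso (cls σ R • c)).1 = σ • (R.carrier ∩ (ρ.complexIso c).1) := by
  rw [complexIso_smul, facetAction_cls]

theorem cls_smul_coset_eq_iff {σ τ τ' : ρ.weyl} {R : ρ.Face} {J J' : Set I} :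
    (cls σ R : ρ.WHat) • ρ.coset τ J = ρ.coset τ' J' ↔
      σ • (R.carrier ∩ τ • ρ.closedFacet J) = τ' • ρ.closedFacet J' := by
  rw [← ρ.complexIso.injective.eq_iff, complexIso_coset, Subtype.ext_iff, complexIso_cls_smul,
    complexIso_coset]
  rfl

/-- The point x = wc lies in wF̄_J = R ∩ wC̄, on which σ⟨R⟩ acts as σ. Equality of the images forces
R' to contain this facet, and forces σ and σ' to differ on it by an element stabilizing it, hence
fixing it pointwise. -/
theorem mem_and_smul_eq_of_action_eq {σ σ' : ρ.weyl} {R R' : ρ.Face}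
    (heq : ∀ c : ρ.Complex, (cls σ R : ρ.WHat) • c = (cls σ' R' : ρ.WHat) • c)
    {x : Module.Dual ℝ h} (hx : x ∈ R.carrier) : x ∈ R'.carrier ∧ (σ⁻¹ * σ') • x = x := by
  obtain ⟨w, c, hc, rfl⟩ := ρ.mem_titsCone.1 (R.mem_titsCone hx)
  obtain ⟨J, hJ⟩ := R.exists_inter_smul_closedFacet w ∅
  obtain ⟨J', hJ'⟩ := R'.exists_inter_smul_closedFacet w J
  have hcJ : w • c ∈ w • ρ.closedFacet J := by
    rw [← hJ]
    exact ⟨hx, Set.smul_mem_smul_set ⟨by simp, fun i _ => hc i⟩⟩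
  have h1 := congrArg (fun d => (ρ.complexIso d).1) (heq (ρ.coset w J))
  simp only [complexIso_cls_smul, complexIso_coset] at h1
  change σ • (R.carrier ∩ w • ρ.closedFacet J) = σ' • (R'.carrier ∩ w • ρ.closedFacet J) at h1
  rw [Set.inter_eq_self_of_subset_right (hJ ▸ Set.inter_subset_left), hJ', ← mul_smul,
    ← mul_smul] at h1
  obtain ⟨h2, -⟩ := ρ.of_smul_closedFacet_subset h1.le
  obtain ⟨h3, h4⟩ := ρ.of_smul_closedFacet_subset h1.ge
  obtain rfl := h2.antisymm h3
  refine ⟨(hJ' ▸ hcJ : w • c ∈ R'.carrier ∩ _).1, ?_⟩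
  have h5 : c ∈ ρ.closedFacet J' := Set.smul_mem_smul_set_iff.1 hcJ
  have h6 := ρ.parabolic_smul_eq h4 h5.1
  rw [mul_inv_rev, mul_assoc, mul_smul, inv_smul_eq_iff] at h6
  rw [← mul_smul, mul_assoc, ← h6]

theorem faithful_complexAction : FaithfulSMul ρ.WHat ρ.Complex where
  eq_of_smul_eq_smul {m n} hmn := by
    obtain ⟨σ, R, rfl⟩ := m.exists_cls
    obtain ⟨σ', R', rfl⟩ := n.exists_cls
    refine (Con.eq ρ.con).2 ⟨Face.ext (Set.Subset.antisymm
      (fun x hx => (ρ.mem_and_smul_eq_of_action_eq hmn hx).1)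
      (fun x hx => (ρ.mem_and_smul_eq_of_action_eq (fun c => (hmn c).symm) hx).1)),
      fun x hx => (ρ.mem_and_smul_eq_of_action_eq hmn hx).2⟩

theorem isGoodAction : ρ.IsGoodAction where
  extends_weyl σ c := by
    obtain ⟨τ, J, rfl⟩ := c.eq_coset
    have : σ • ρ.coset τ J = ρ.coset (σ * τ) J := Subtype.ext (mul_smul σ τ _).symm
    rw [this]
    refine (ρ.cls_smul_coset_eq_iff).2 ?_
    rw [mul_smul]
    exact congrArg _ (Set.inter_eq_self_of_subset_right (ρ.smul_closedFacet_subset_titsCone τ J))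
  stabilizer J := by
    ext m
    constructor
    · intro hm
      obtain ⟨σ, R, rfl⟩ := m.exists_cls
      have h1 := ρ.cls_smul_coset_eq_iff.1 hm
      obtain ⟨J', hJ'⟩ := R.exists_inter_closedFacet J
      rw [one_smul, hJ'] at h1
      have h2 : σ • ρ.closedFacet J' = (1 : ρ.weyl) • ρ.closedFacet J := by
        rw [one_smul]; exact h1
      obtain ⟨h3, h4⟩ := ρ.of_smul_closedFacet_subset h2.le
      obtain ⟨h5, -⟩ := ρ.of_smul_closedFacet_subset h2.ge
      obtain rfl := h3.antisymm h5
      -- Stability gives R ∩ F̄_J = F̄_J, so R contains a generic point of F̄_J and therefore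
      -- R(J^∞).
      obtain ⟨f, hf, hf'⟩ := ρ.exists_generic J
      have hfR : f ∈ R.carrier ∩ ρ.closedFacet J := by
        rw [hJ']; exact ⟨hf, fun i hi => (hf' i hi).le⟩
      exact ⟨σ, by simpa using h4, R, ρ.specialSet_inf_subset R hfR.1 hf hf',
        cls_eq_unit_mul_idem σ R⟩
    · rintro ⟨σ, hσ, R, hR, rfl⟩
      rw [← cls_eq_unit_mul_idem]
      refine ρ.cls_smul_coset_eq_iff.2 ?_
      rw [one_smul, Set.inter_eq_self_of_subset_right, ρ.parabolic_smul_closedFacet hσ]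
      exact (ρ.closedFacet_anti (GCM.inf_subset J)).trans
        ((ρ.closedFacet_subset_specialSet _).trans hR)
  order_preserving m c d hcd := by
    obtain ⟨σ, R, rfl⟩ := m.exists_cls
    rw [← ρ.complexIso.le_iff_le] at hcd ⊢
    change (ρ.complexIso (cls σ R • c)).1 ⊆ (ρ.complexIso (cls σ R • d)).1
    rw [complexIso_cls_smul, complexIso_cls_smul]
    exact Set.smul_set_mono (Set.inter_subset_inter_right _ hcd)

end Realization

namespace Realization

variable {I : Type*} {A : GCM I} {h : Type*} [AddCommGroup h] [Module ℝ h] (ρ : Realization A h)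

/-! ### Double cosets -/

theorem commute_of_mem_perp {Θ : Set I} {i : I} (hi : i ∈ Θ) {w : ρ.weyl}
    (hw : w ∈ ρ.parabolic (A.perp Θ)) : Commute (ρ.simple i) w := by
  induction hw using Subgroup.closure_induction with
  | mem x hx =>
    obtain ⟨k, hk, rfl⟩ := hx
    have := braid_two (ρ := ρ) (hk i hi) ((A.zero_iff k i).1 (hk i hi))
    change ρ.simple i * ρ.simple k = ρ.simple k * ρ.simple i
    simpa [Braid, CoxeterSystem.alternatingWord] using this.symm
  | one => exact Commute.one_right _
  | mul x y _ _ hx hy => exact hx.mul_right hy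
  | inv x _ hx => exact hx.inv_right

theorem exists_mul_of_mem_parabolic_union_perp {Θ : Set I} {w : ρ.weyl}
    (hw : w ∈ ρ.parabolic (Θ ∪ A.perp Θ)) :
    ∃ a₁ ∈ ρ.parabolic (A.perp Θ), ∃ a₂ ∈ ρ.parabolic Θ, w = a₁ * a₂ := by
  obtain ⟨L, hL, rfl⟩ := ρ.exists_wordProd_of_mem_parabolic hw
  clear hw
  induction L with
  | nil => exact ⟨1, one_mem _, 1, one_mem _, by simp⟩
  | cons i L ih =>
    obtain ⟨a₁, h₁, a₂, h₂, he⟩ := ih fun j hj => hL j (by simp [hj])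
    rw [wordProd_cons, he]
    rcases hL i (by simp) with hi | hi
    · exact ⟨a₁, h₁, ρ.simple i * a₂, mul_mem (ρ.simple_mem_parabolic hi) h₂, by
        rw [← mul_assoc, (ρ.commute_of_mem_perp hi h₁).eq, mul_assoc]⟩
    · exact ⟨ρ.simple i * a₁, mul_mem (ρ.simple_mem_parabolic hi) h₁, a₂, h₂,
        (mul_assoc _ _ _).symm⟩

theorem exists_minRep (K J : Set I) (w : ρ.weyl) :
    ∃ b ∈ ρ.parabolic K, ∃ y ∈ ρ.minRep K J, ∃ c ∈ ρ.parabolic J, w = b * y * c := by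
  let S : Set ℕ := {n | ∃ b ∈ ρ.parabolic K, ∃ c ∈ ρ.parabolic J, ρ.length (b * w * c) = n}
  have hS : S.Nonempty := ⟨_, 1, one_mem _, 1, one_mem _, rfl⟩
  obtain ⟨b, hb, c, hc, hlen⟩ := Nat.sInf_mem hS
  refine ⟨b⁻¹, inv_mem hb, b * w * c, fun b' hb' c' hc' => ?_, c⁻¹, inv_mem hc, by group⟩
  rw [hlen]
  exact Nat.sInf_le ⟨b' * b, mul_mem hb' hb, c * c', mul_mem hc hc', by simp only [mul_assoc]⟩

theorem exists_decomposition (Θ J : Set I) (w : ρ.weyl) :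
    ∃ a₁ ∈ ρ.parabolic (A.perp Θ), ∃ a₂ ∈ ρ.parabolic Θ, ∃ y ∈ ρ.minRep (Θ ∪ A.perp Θ) J,
      ∃ c ∈ ρ.parabolic J, w = a₁ * a₂ * y * c := by
  obtain ⟨b, hb, y, hy, c, hc, rfl⟩ := ρ.exists_minRep (Θ ∪ A.perp Θ) J w
  obtain ⟨a₁, h₁, a₂, h₂, rfl⟩ := ρ.exists_mul_of_mem_parabolic_union_perp hb
  exact ⟨a₁, h₁, a₂, h₂, y, hy, c, hc, rfl⟩

theorem red_subset_of_mem_parabolic {K : Set I} {y : ρ.weyl} (hy : y ∈ ρ.parabolic K) :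
    ρ.red y ⊆ K := by
  rintro i ⟨L, rfl, hlen, hi⟩
  exact ρ.mem_of_reduced hlen hy i hi

theorem mem_parabolic_red (y : ρ.weyl) : y ∈ ρ.parabolic (ρ.red y) := by
  obtain ⟨L, rfl, hL⟩ := ρ.exists_reduced y
  exact ρ.wordProd_mem_parabolic fun i hi => ⟨L, rfl, hL, hi⟩

/-- The intersection of a special face with a closed facet. -/
theorem specialSet_inter_smul_closedFacet {Θ J : Set I} {y : ρ.weyl}
    (hy : y ∈ ρ.minRep (Θ ∪ A.perp Θ) J) :
    ρ.specialSet Θ ∩ y • ρ.closedFacet J = ρ.closedFacet (Θ ∪ J ∪ ρ.red y) := by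
  refine Set.Subset.antisymm ?_ fun l hl => ?_
  · rintro l ⟨hlΘ, f, hf, rfl⟩
    have hfC := ρ.closedFacet_subset_chamber J hf
    obtain ⟨w, hw, g, hg, hwg⟩ := ρ.mem_specialSet.1 hlΘ
    have hgC := ρ.closedFacet_subset_chamber Θ hg
    -- Minimality of y under left multiplication by W_{Θ^⊥} makes yf = wg dominant for Θ^⊥, and w ∈
    -- W_{Θ^⊥} cannot move g to a different such point.
    have hyfix : w • g = g := ρ.eq_of_parabolic_dominant hw hgC fun i hi => by
      rw [← hwg]
      refine ρ.smul_apply_coroot_nonneg hfC ?_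
      simpa using hy (ρ.simple i) (ρ.simple_mem_parabolic (.inr hi)) 1 (one_mem _)
    have hyg : y • f = g := hwg.trans hyfix
    -- Now f and yf both lie in the chamber, so y fixes f and its letters are among the zeros of f.
    obtain ⟨rfl, hyf⟩ := ρ.eq_of_chamber hfC hgC hyg
    change y • f ∈ _
    rw [hyg]
    refine ⟨?_, fun i _ => hfC i⟩
    rintro i ((hi | hi) | hi)
    · exact hg.1 i hi
    · exact hf.1 i hi
    · exact ρ.red_subset_of_mem_parabolic hyf hi
  · refine ⟨ρ.closedFacet_subset_specialSet Θ (ρ.closedFacet_anti ?_ hl),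
      l, ρ.closedFacet_anti ?_ hl, ρ.parabolic_smul_eq (ρ.mem_parabolic_red y)
        fun i hi => hl.1 i (.inr hi)⟩
    · exact fun i hi => .inl (.inl hi)
    · exact fun i hi => .inl (.inr hi)

theorem smul_specialSet {Θ : Set I} {a : ρ.weyl} (ha : a ∈ ρ.parabolic (A.perp Θ)) :
    a • ρ.specialSet Θ = ρ.specialSet Θ := by
  ext l
  rw [Set.mem_smul_set_iff_inv_smul_mem]
  refine ⟨fun hl => ?_, ρ.smul_mem_specialSet (inv_mem ha)⟩
  simpa using ρ.smul_mem_specialSet ha hl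

theorem parabolic_smul_of_subset_specialSet {Θ : Set I} {a : ρ.weyl} (ha : a ∈ ρ.parabolic Θ)
    {S : Set (Module.Dual ℝ h)} (hS : S ⊆ ρ.specialSet Θ) : a • S = S := by
  have : ∀ l ∈ S, a • l = l := fun l hl =>
    ρ.parabolic_smul_eq ha fun i hi => ρ.specialSet_apply_eq_zero (hS hl) hi
  exact (Set.image_congr this).trans (Set.image_id' S)

theorem specialSet_inter_decomposition {Θ J : Set I} {a₁ a₂ y c : ρ.weyl}
    (h₁ : a₁ ∈ ρ.parabolic (A.perp Θ)) (h₂ : a₂ ∈ ρ.parabolic Θ)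
    (hy : y ∈ ρ.minRep (Θ ∪ A.perp Θ) J) (hc : c ∈ ρ.parabolic J) :
    ρ.specialSet Θ ∩ (a₁ * a₂ * y * c) • ρ.closedFacet J =
      a₁ • ρ.closedFacet (Θ ∪ J ∪ ρ.red y) := by
  rw [← ρ.specialSet_inter_smul_closedFacet hy]
  conv_rhs => rw [← ρ.parabolic_smul_of_subset_specialSet h₂ Set.inter_subset_left]
  rw [Set.smul_set_inter, ρ.parabolic_smul_of_subset_specialSet h₂ subset_rfl, Set.smul_set_inter,
    ρ.smul_specialSet h₁, mul_smul, ρ.parabolic_smul_closedFacet hc, mul_smul, mul_smul]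

theorem exists_eq_unit_mul_idem_mul_unit [Finite I] [FiniteDimensional ℝ h] (m : ρ.WHat) :
    ∃ (σ₁ σ₂ : ρ.weyl) (Θ : Set I) (R : ρ.Face), A.IsSpecial Θ ∧
      R.carrier = ρ.specialSet Θ ∧ m = unit σ₁ * idem R * unit σ₂ := by
  obtain ⟨σ, S, rfl⟩ := m.exists_cls
  obtain ⟨w, Θ, hΘ, hS⟩ := ρ.exists_carrier_eq_smul_specialSet S
  obtain ⟨R, hR⟩ := ρ.exists_face_specialSet hΘ
  -- For S = wR(Θ), σ⟨S⟩ = σw⟨R(Θ)⟩w⁻¹.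
  refine ⟨σ * w, w⁻¹, Θ, R, hΘ, hR, ?_⟩
  rw [← cls_eq_unit_mul_idem, cls_mul_unit, mul_inv_cancel_right]
  congr 1
  exact Face.ext (by rw [Face.carrier_translateInv, inv_inv, hR, hS])

end Realization

end FaceMonoid

theorem mainTheorem4 {I : Type*} [Finite I] {A : FaceMonoid.GCM I}
    {h : Type*} [AddCommGroup h] [Module ℝ h] [FiniteDimensional ℝ h]
    (ρ : FaceMonoid.Realization A h) :
    -- the Tits cone is the union of the translates of the closed fundamental chamber
    (ρ.titsCone : Set (Module.Dual ℝ h)) = ⋃ w : ρ.weyl, w • ρ.chamber ∧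
    -- the sets `R(Θ)`, for `Θ` special, are faces
    (∀ Θ : Set I, A.IsSpecial Θ → ∃ R : ρ.Face, R.carrier = ρ.specialSet Θ) ∧
    -- every element of the face monoid is of the form `σ₁⟨R(Θ)⟩σ₂`
    (∀ m : ρ.WHat, ∃ (σ₁ σ₂ : ρ.weyl) (Θ : Set I) (R : ρ.Face), A.IsSpecial Θ ∧
      R.carrier = ρ.specialSet Θ ∧
      m = FaceMonoid.Realization.unit σ₁ * FaceMonoid.Realization.idem R *
        FaceMonoid.Realization.unit σ₂) ∧
    -- every element of the Weyl group can be decomposed in the form `a₁ a₂ y c`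
    (∀ (Θ J : Set I) (w : ρ.weyl), A.IsSpecial Θ →
      ∃ a₁ ∈ ρ.parabolic (A.perp Θ), ∃ a₂ ∈ ρ.parabolic Θ, ∃ y ∈ ρ.minRep (Θ ∪ A.perp Θ) J,
        ∃ c ∈ ρ.parabolic J, w = a₁ * a₂ * y * c) ∧
    -- the Coxeter complex identifies with the partially ordered set of closed facets
    ∃ e : ρ.Complex ≃o ρ.Facet,
      (∀ (τ : ρ.weyl) (J : Set I), e (ρ.coset τ J) = ρ.facet τ J) ∧
      -- the action
      ∃ _ : MulAction ρ.WHat ρ.Complex,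
        FaithfulSMul ρ.WHat ρ.Complex ∧
        ρ.IsGoodAction ∧
        (∀ (σ : ρ.weyl) (R : ρ.Face) (F : ρ.Complex),
          (e (FaceMonoid.Realization.cls σ R • F) : Set (Module.Dual ℝ h)) =
            σ • (R.carrier ∩ (e F : Set (Module.Dual ℝ h)))) ∧
        (∀ (Θ : Set I) (R : ρ.Face), A.IsSpecial Θ → R.carrier = ρ.specialSet Θ →
          ∀ (σ₁ σ₂ τ : ρ.weyl) (J : Set I),
          ∀ a₁ ∈ ρ.parabolic (A.perp Θ), ∀ a₂ ∈ ρ.parabolic Θ,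
          ∀ y ∈ ρ.minRep (Θ ∪ A.perp Θ) J, ∀ c ∈ ρ.parabolic J,
            σ₂ * τ = a₁ * a₂ * y * c →
            (FaceMonoid.Realization.unit σ₁ * FaceMonoid.Realization.idem R *
                FaceMonoid.Realization.unit σ₂ : ρ.WHat) • ρ.coset τ J =
              ρ.coset (σ₁ * a₁) (Θ ∪ J ∪ ρ.red y)) := by
  refine ⟨ρ.coe_titsCone, fun Θ hΘ => ρ.exists_face_specialSet hΘ,
    ρ.exists_eq_unit_mul_idem_mul_unit, fun Θ J w _ => ρ.exists_decomposition Θ J w,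
    ρ.complexIso, ρ.complexIso_coset, ρ.complexAction, ρ.faithful_complexAction, ρ.isGoodAction,
    ρ.complexIso_cls_smul, ?_⟩
  intro Θ R _ hR σ₁ σ₂ τ J a₁ h₁ a₂ h₂ y hy c hc he
  -- The element equals σ₁σ₂⟨σ₂⁻¹R(Θ)⟩, so it sends τF̄_J to σ₁(R(Θ) ∩ σ₂τF̄_J).
  rw [← FaceMonoid.Realization.cls_eq_unit_mul_idem, FaceMonoid.Realization.cls_mul_unit]
  refine ρ.cls_smul_coset_eq_iff.2 ?_
  rw [FaceMonoid.Realization.Face.carrier_translateInv, hR, mul_smul, Set.smul_set_inter,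
    smul_inv_smul, ← mul_smul, he, ρ.specialSet_inter_decomposition h₁ h₂ hy hc, ← mul_smul]
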